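/- Let $d\ge 2$, let $(\mathcal A,d_{\mathcal A})$ be a compact metric space, $X:=\mathbb S^{d-1}\times\mathcal A$, and $d_X((x,\xi),(y,\zeta)):=\|x-y\|+d_{\mathcal A}(\xi,\zeta)$; let $\mathcal P(X)$ be the set of Borel probability measures on $X$ with the weak topology, and let $W_1$ be the 1-Wasserstein distance on $\mathcal P(X)$ for $d_X$. Let $h:X\times X\to\mathbb R$ be a regular kernel: $h$ is bounded, symmetric and continuous, differentiable in the content variable $x$ of its first argument with gradient $\nabla_xh((x,\xi),(y,\zeta))\in\mathbb R^d$, and $\nabla_xh$ is continuous in $(x,y)$ and satisfies, for constants $M_h,L_x$, $$\|\nabla_xh(z,z')\|\le M_h,\qquad \|\nabla_xh((x,\xi),z')-\nabla_xh((x',\xi),z')\|\le L_x\|x-x'\| .$$ Assume also that for a constant $L_\mu$ $$\|\nabla_xh(z,w)-\nabla_xh(z,w')\|\le L_\mu\, d_X(w,w')\qquad(z,w,w'\in X).\tag{a}$$ Put $P_x^\perp:=I-xx^\top$, $V[\mu](x,\xi):=P_x^\perp\int_X\nabla_xh((x,\xi),w)\,d\mu(w)$ and $L_V:=L_x+2M_h$.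 A weak solution of the continuity equation $$\partial_\tau\mu_\tau+\operatorname{div}_x(\mu_\tau V[\mu_\tau])=0\quad\text{on }X$$ is a curve $\mu\in C([0,\infty);\mathcal P(X))$ such that for every continuous $\varphi:X\to\mathbb R$ that is differentiable in $x$ with $\nabla_x\varphi$ continuous on $X$, the map $\tau\mapsto\int\varphi\,d\mu_\tau$ is absolutely continuous on every $[0,T]$ and $\frac{d}{d\tau}\int\varphi\,d\mu_\tau=\int\langle\nabla_x\varphi,V[\mu_\tau]\rangle\,d\mu_\tau$ for a.e. $\tau\ge0$. (i) For every $\mu_0\in\mathcal P(X)$ there is exactly one weak solution $\mu\in C([0,\infty);\mathcal P(X))$ with initial datum $\mu_0$. Assume in addition $$\|\nabla_xh(z,w)-\nabla_xh(z',w)\|\le L_x\, d_X(z,z')\qquad(z,z',w\in X).\tag{b}$$ (ii) Any two weak solutions $\mu,\nu$ satisfy $W_1(\mu_\tau,\nu_\tau)\le e^{(L_V+L_\mu)\tau}\,W_1(\mu_0,\nu_0)$ for all $\tau\ge0$. (iii) For every $T>0$ there is a constant $C_T$ with the following property. Let $\rho$ be a Borel probability measure on $\mathcal A$ and let $\mu$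 be a weak solution such that $\mu_0$ has marginal $\rho$ on $\mathcal A$. For each $n\ge1$ let $\xi^n_1,\dots,\xi^n_n\in\mathcal A$ and let $x^n_1,\dots,x^n_n:[0,\infty)\to\mathbb S^{d-1}$ solve $$\dot x^n_i=P^\perp_{x^n_i}\Bigl[\frac1n\sum_{j=1}^n\nabla_xh\bigl((x^n_i,\xi^n_i),(x^n_j,\xi^n_j)\bigr)\Bigr],\qquad i=1,\dots,n,$$ and put $\mu^{(n)}_\tau:=\frac1n\sum_{i=1}^n\delta_{(x^n_i(\tau),\xi^n_i)}$. If $W_1(\mu^{(n)}_0,\mu_0)\to0$ as $n\to\infty$, then $$\sup_{0\le\tau\le T}W_1(\mu^{(n)}_\tau,\mu_\tau)\le e^{C_T}\,W_1(\mu^{(n)}_0,\mu_0)\quad\text{for all }n,\qquad\text{and}\qquad \sup_{0\le\tau\le T}W_1(\mu^{(n)}_\tau,\mu_\tau)\to0 .$$ -/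

import Mathlib

open MeasureTheory Filter Topology Set
open scoped NNReal ENNReal

noncomputable section

namespace USAAV

/-- The ambient space `ℝ^d` with its Euclidean norm. -/
abbrev Amb (d : ℕ) : Type := EuclideanSpace ℝ (Fin d)

/-- The unit sphere `𝕊^{d-1} ⊂ ℝ^d`. -/
abbrev Sph (d : ℕ) : Type := Metric.sphere (0 : Amb d) 1

/-- The state space `X = 𝕊^{d-1} × 𝒜` (content variable, auxiliary variable). -/
abbrev State (d : ℕ) (A : Type*) : Type _ := Sph d × A

/-- The metric `d_X((x,ξ),(y,ζ)) = ‖x - y‖ + d_𝒜(ξ,ζ)`. It induces the product topology,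
which is the one Lean uses on `State d A`. -/
def dX {d : ℕ} {A : Type*} [MetricSpace A] (z w : State d A) : ℝ :=
  ‖(z.1 : Amb d) - (w.1 : Amb d)‖ + dist z.2 w.2

/-- The projection `P_x^⊥ = I - x xᵀ` onto the tangent space of the sphere at `x`. -/
def tangentProj {d : ℕ} (x : Sph d) (v : Amb d) : Amb d :=
  v - (inner ℝ (x : Amb d) v) • (x : Amb d)

/-- `g ∈ ℝ^d` is a gradient at `x` of the function `f` on the sphere:
`f x' = f x + ⟨g, x' - x⟩ + o(‖x' - x‖)` as `x' → x` in the sphere.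
The tangential gradient has this property, and so does the ambient gradient of every extension
of `f` to a neighbourhood of `x` that is differentiable at `x`. The tangential component of `g`
is determined by `f`. -/
def HasSphereGradientAt {d : ℕ} (f : Sph d → ℝ) (g : Amb d) (x : Sph d) : Prop :=
  (fun x' : Sph d => f x' - f x - inner ℝ g ((x' : Amb d) - (x : Amb d)))
    =o[𝓝 x] (fun x' : Sph d => (x' : Amb d) - (x : Amb d))

section

variable {d : ℕ} {A : Type*} [MetricSpace A]

/-- Regular kernels. `gradh z z'` is the gradient `∇_x h((x,ξ),(y,ζ)) ∈ ℝ^d` in the content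
variable `x` of the first argument `z = (x,ξ)`; here `z' = (y,ζ)`. -/
structure IsRegularKernel (h : State d A → State d A → ℝ)
    (gradh : State d A → State d A → Amb d) (Lx Mh : ℝ) : Prop where
  bounded : ∃ B : ℝ, ∀ z z', |h z z'| ≤ B
  symmetric : ∀ z z', h z z' = h z' z
  continuous : Continuous (fun p : State d A × State d A => h p.1 p.2)
  hasGradient : ∀ (x : Sph d) (ξ : A) (z' : State d A),
    HasSphereGradientAt (fun x' => h (x', ξ) z') (gradh (x, ξ) z') x
  continuous_grad : ∀ ξ ζ : A,
    Continuous (fun p : Sph d × Sph d => gradh (p.1, ξ) (p.2, ζ))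
  lipschitz_grad : ∀ (x x' : Sph d) (ξ : A) (z' : State d A),
    ‖gradh (x, ξ) z' - gradh (x', ξ) z'‖ ≤ Lx * ‖(x : Amb d) - (x' : Amb d)‖
  bounded_grad : ∀ z z', ‖gradh z z'‖ ≤ Mh

/-- Lipschitz bound on `∇_x h` with respect to its (whole) first argument. -/
def FirstArgLipschitz (gradh : State d A → State d A → Amb d) (Lx : ℝ) : Prop :=
  ∀ z z' w, ‖gradh z w - gradh z' w‖ ≤ Lx * dX z z'

/-- Lipschitz bound on `∇_x h` with respect to its second argument. -/
def SecondArgLipschitz (gradh : State d A → State d A → Amb d) (Lμ : ℝ) : Prop :=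
  ∀ z w w', ‖gradh z w - gradh z w'‖ ≤ Lμ * dX w w'

/-- `φ ∈ C¹(X)` with gradient `gradφ` in the content variable: `φ` is continuous,
differentiable in `x` with gradient `gradφ`, and `gradφ` is continuous on `X`. -/
structure IsC1 (φ : State d A → ℝ) (gradφ : State d A → Amb d) : Prop where
  continuous : Continuous φ
  hasGradient : ∀ (x : Sph d) (ξ : A),
    HasSphereGradientAt (fun x' => φ (x', ξ)) (gradφ (x, ξ)) x
  continuous_grad : Continuous gradφ

variable [MeasurableSpace A]

/-- The velocity field `V[μ](x,ξ) = P_x^⊥ [∫ ∇_x h((x,ξ),(y,ζ)) dμ(y,ζ)]`. -/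
def velocity (gradh : State d A → State d A → Amb d) (μ : Measure (State d A))
    (z : State d A) : Amb d :=
  tangentProj z.1 (∫ w, gradh z w ∂μ)

/-- The 1-Wasserstein distance for `d_X`: the infimum of `∫ d_X dπ` over the couplings `π`. -/
def W1 (μ ν : ProbabilityMeasure (State d A)) : ℝ≥0∞ :=
  ⨅ (π : Measure (State d A × State d A))
    (_ : π.map Prod.fst = (μ : Measure (State d A)) ∧ π.map Prod.snd = (ν : Measure (State d A))),
    ∫⁻ p, ENNReal.ofReal (dX p.1 p.2) ∂π

/-- The class `𝒫_ρ` of joint laws whose auxiliary marginal is `ρ`. -/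
def fixedMarginal (ρ : ProbabilityMeasure A) : Set (ProbabilityMeasure (State d A)) :=
  {μ | (μ : Measure (State d A)).map Prod.snd = (ρ : Measure A)}

/-- Weak solutions on `[0,∞)` of `∂_τ μ_τ + div_x(μ_τ V[μ_τ]) = 0`: for every `φ ∈ C¹(X)` the
map `τ ↦ ∫ φ dμ_τ` is absolutely continuous on every `[0,T]`, and for a.e. `τ ≥ 0` its derivative
is `∫ ⟨∇_x φ, V[μ_τ]⟩ dμ_τ`. -/
def IsWeakSolution (gradh : State d A → State d A → Amb d)
    (μ : ℝ≥0 → ProbabilityMeasure (State d A)) : Prop :=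
  ∀ (φ : State d A → ℝ) (gradφ : State d A → Amb d), IsC1 φ gradφ →
    (∀ T : ℝ, 0 ≤ T → AbsolutelyContinuousOnInterval
      (fun τ : ℝ => ∫ z, φ z ∂(μ τ.toNNReal : Measure (State d A))) 0 T) ∧
    (∀ᵐ τ : ℝ ∂(volume.restrict (Ici (0 : ℝ))),
      HasDerivAt (fun τ : ℝ => ∫ z, φ z ∂(μ τ.toNNReal : Measure (State d A)))
        (∫ z, inner ℝ (gradφ z) (velocity gradh (μ τ.toNNReal : Measure (State d A)) z)
          ∂(μ τ.toNNReal : Measure (State d A))) τ)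

/-- The empirical law `(1/n) ∑ δ_{z_i}` of `n ≥ 1` points. -/
def empiricalLaw {n : ℕ} [NeZero n] (z : Fin n → State d A) :
    ProbabilityMeasure (State d A) :=
  ⟨(n : ℝ≥0∞)⁻¹ • ∑ i, Measure.dirac (z i), ⟨by
    simp [ENNReal.inv_mul_cancel (Nat.cast_ne_zero.mpr (NeZero.ne n)) (ENNReal.natCast_ne_top n)]⟩⟩

end

/-- The finite-particle system with auxiliary labels `ξ_1, …, ξ_n`: on `[0,∞)`,
`ẋ_i = P_{x_i}^⊥ [(1/n) ∑_j ∇_x h((x_i,ξ_i),(x_j,ξ_j))]`, with `x_i(τ)` on the sphere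
(one-sided derivative at `τ = 0`; the values of `x` at negative times play no role). -/
def IsParticleSolution {d : ℕ} {A : Type*} (gradh : State d A → State d A → Amb d) {n : ℕ}
    (ξ : Fin n → A) (x : Fin n → ℝ → Sph d) : Prop :=
  ∀ (i : Fin n) (τ : ℝ), 0 ≤ τ →
    HasDerivWithinAt (fun t : ℝ => (x i t : Amb d))
      (tangentProj (x i τ)
        ((n : ℝ)⁻¹ • ∑ j, gradh (x i τ, ξ i) (x j τ, ξ j)))
      (Ici (0 : ℝ)) τ

end USAAV

end

/-! The equation moves mass along characteristics `ẋ = V[μ_τ](x, ξ)` with the label `ξ` frozen.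

Existence. The law at time `τ` is the image of `μ₀` under the flow map `Φ_τ`, so the nonlinear
equation closes as an autonomous ODE for `Φ` in the Banach space `C(X, ℝ^d)`. Once the tangential
kernel `P_x^⊥ ∇_x h` is extended radially to `ℝ^d` in both content variables, the field of this ODE
is bounded and globally Lipschitz, and tangency keeps the solution on the sphere (`exists_isFlow`).
Laws of random characteristics solve the weak equation (`IsLagrangian.isWeakSolution`); this covers
the flow and also the particle systems.

Uniqueness is proved by duality, without first representing weak solutions by characteristics. Two
laws are compared on test functions that are `Λ`-Lipschitz in `x` and merely continuous in `ξ`: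
labels do not move, and under (a) alone the field is only continuous in its own label. Mollifying
`f` in `x` makes it admissible. Over a time step `ε`, testing the mollified `f` at time `t + ε`
amounts to testing at time `t` the mollification of `f ∘ (id + εb)`, up to `O(ε²) + O(εδ)`, where
`b` is the current velocity and `δ` the mollification radius. The Euler step multiplies the
Lipschitz constant by `1 + O(ε)`, and the two velocities differ by a multiple of the same distance
plus `O(δ)` (`mollifiedClose_step`). A discrete Gronwall argument lets `ε → 0` with `δ` fixed, so
the `ε²` constant, which involves `∫ ‖∇ρ‖`, disappears; then `δ` is made small.

Stability and mean-field limit. By uniqueness every weak solution is the law of its flow. Pushing a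
coupling of the initial laws forward by both flows gives a coupling at time `τ`, whose cost obeys
Gronwall with rate `L_V + L_μ` (`flowCost_le`). Empirical laws are weak solutions, so the mean-field
limit is a case of stability. -/

open MeasureTheory Filter Topology Set
open scoped NNReal ENNReal

set_option linter.unusedSectionVars false

noncomputable section

namespace USAAV

/-! ### Spherical gradients, tangential projection and regularity of the tangential kernel -/

section Kernel

variable {d : ℕ} {A : Type*} [MetricSpace A]

/-- Chain rule along a curve in the sphere. -/
theorem HasSphereGradientAt.comp_hasDerivWithinAt {f : Sph d → ℝ} {g : Amb d} {γ : ℝ → Sph d}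
    {v : Amb d} {t : ℝ} {s : Set ℝ} (hf : HasSphereGradientAt f g (γ t))
    (hγ : HasDerivWithinAt (fun s => (γ s : Amb d)) v s t) :
    HasDerivWithinAt (fun s => f (γ s)) (inner ℝ g v) s t := by
  have hcont : Tendsto γ (𝓝[s] t) (𝓝 (γ t)) := tendsto_subtype_rng.2 hγ.continuousWithinAt
  have hpair : Tendsto (fun r : ℝ => (r, t)) (𝓝[s] t) (𝓝[s] t ×ˢ pure t) :=
    tendsto_id.prodMk (tendsto_pure.2 (Eventually.of_forall fun _ => rfl))
  have h1 := (hf.comp_tendsto hcont).trans_isBigO (hγ.isBigO_sub.comp_tendsto hpair)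
  have h2 : HasDerivWithinAt (fun s => inner ℝ g (γ s : Amb d)) (inner ℝ g v) s t := by
    have := (innerSL ℝ g).hasFDerivAt.comp_hasDerivWithinAt t hγ
    simpa [Function.comp_def] using this
  rw [hasDerivWithinAt_iff_isLittleO] at h2 ⊢
  refine (h1.add h2).congr_left fun s => ?_
  simp only [Function.comp_apply, inner_sub_right]
  ring

theorem HasSphereGradientAt.comp_hasDerivAt {f : Sph d → ℝ} {g : Amb d} {γ : ℝ → Sph d}
    {v : Amb d} {t : ℝ} (hf : HasSphereGradientAt f g (γ t))
    (hγ : HasDerivAt (fun s => (γ s : Amb d)) v t) :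
    HasDerivAt (fun s => f (γ s)) (inner ℝ g v) t := by
  rw [← hasDerivWithinAt_univ] at hγ ⊢
  exact hf.comp_hasDerivWithinAt hγ

theorem norm_sph (x : Sph d) : ‖(x : Amb d)‖ = 1 := mem_sphere_zero_iff_norm.mp x.2

theorem tangentProj_eq_sub (x : Sph d) (v : Amb d) :
    tangentProj x v = v - (inner ℝ (x : Amb d) v) • (x : Amb d) := rfl

/-- The tangential projection as a continuous linear map. -/
def tangentProjL (x : Sph d) : Amb d →L[ℝ] Amb d :=
  ContinuousLinearMap.id ℝ (Amb d) - (innerSL ℝ (x : Amb d)).smulRight (x : Amb d)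

theorem tangentProjL_apply (x : Sph d) (v : Amb d) : tangentProjL x v = tangentProj x v := by
  simp [tangentProjL, tangentProj]

theorem inner_tangentProj_self (x : Sph d) (v : Amb d) :
    inner ℝ (x : Amb d) (tangentProj x v) = 0 := by
  simp [tangentProj, inner_sub_right, inner_smul_right]

theorem inner_tangentProj_comm (x : Sph d) (v e : Amb d) :
    inner ℝ (tangentProj x v) e = inner ℝ v (tangentProj x e) := by
  simp only [tangentProj, inner_sub_right, inner_sub_left, inner_smul_right, inner_smul_left]
  simp [real_inner_comm]
  ring

theorem norm_tangentProj_le (x : Sph d) (v : Amb d) : ‖tangentProj x v‖ ≤ ‖v‖ := by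
  have h : ‖tangentProj x v‖ ^ 2 ≤ ‖tangentProj x v‖ * ‖v‖ := by
    calc ‖tangentProj x v‖ ^ 2 = inner ℝ (tangentProj x v) (tangentProj x v) := by
          rw [real_inner_self_eq_norm_sq]
      _ = inner ℝ (tangentProj x v) v := by
          conv_lhs => rw [tangentProj_eq_sub x v]
          rw [inner_sub_left, inner_smul_left, ← tangentProj_eq_sub, inner_tangentProj_self,
            real_inner_comm]
          simp [real_inner_comm]
      _ ≤ _ := real_inner_le_norm _ _
  by_contra! hlt
  nlinarith [norm_nonneg v, norm_nonneg (tangentProj x v)]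

theorem norm_tangentProj_sub_le (x y : Sph d) (v : Amb d) :
    ‖tangentProj x v - tangentProj y v‖ ≤ 2 * ‖v‖ * ‖(x : Amb d) - y‖ := by
  have : tangentProj x v - tangentProj y v
      = (inner ℝ ((y : Amb d) - x) v) • (y : Amb d) + (inner ℝ (x : Amb d) v) • ((y : Amb d) - x) := by
    simp only [tangentProj, inner_sub_left, sub_smul, smul_sub]
    abel
  rw [this]
  refine (norm_add_le _ _).trans ?_
  rw [norm_smul, norm_smul, norm_sph, norm_sub_rev (x : Amb d)]
  have h1 := norm_inner_le_norm (𝕜 := ℝ) ((y : Amb d) - x) v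
  have h2 := norm_inner_le_norm (𝕜 := ℝ) (x : Amb d) v
  rw [norm_sph] at h2
  have h3 := mul_le_mul_of_nonneg_right h2 (norm_nonneg ((y : Amb d) - x))
  linarith

/-- The great circle through `x` with unit tangent vector `u`. -/
def greatCircle (x : Sph d) (u : Amb d) (hu : ‖u‖ = 1) (hxu : inner ℝ (x : Amb d) u = 0) (t : ℝ) :
    Sph d :=
  ⟨Real.cos t • (x : Amb d) + Real.sin t • u, by
    rw [mem_sphere_zero_iff_norm, ← sq_eq_sq₀ (norm_nonneg _) zero_le_one,
      norm_add_sq_real, norm_smul, norm_smul, inner_smul_left, inner_smul_right, hxu, hu, norm_sph]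
    simp⟩

theorem coe_greatCircle (x : Sph d) (u : Amb d) (hu : ‖u‖ = 1)
    (hxu : inner ℝ (x : Amb d) u = 0) (t : ℝ) :
    (greatCircle x u hu hxu t : Amb d) = Real.cos t • (x : Amb d) + Real.sin t • u := rfl

theorem hasDerivAt_greatCircle (x : Sph d) (u : Amb d) (hu : ‖u‖ = 1)
    (hxu : inner ℝ (x : Amb d) u = 0) (t : ℝ) :
    HasDerivAt (fun s => (greatCircle x u hu hxu s : Amb d))
      ((-Real.sin t) • (x : Amb d) + Real.cos t • u) t :=
  ((Real.hasDerivAt_cos t).smul_const _).add ((Real.hasDerivAt_sin t).smul_const _)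

theorem abs_cos_sub_one_le {t : ℝ} (ht : 0 ≤ t) : |Real.cos t - 1| ≤ t := by
  have := Real.abs_cos_sub_cos_le t 0
  simpa [abs_of_nonneg ht] using this

theorem abs_sin_le_of_nonneg {t : ℝ} (ht : 0 ≤ t) : |Real.sin t| ≤ t := by
  simpa [abs_of_nonneg ht] using Real.abs_sin_le_abs (x := t)

/-- First order Taylor expansion along a great circle of a function with Lipschitz gradient. -/
theorem abs_taylor_greatCircle_le {f : Sph d → ℝ} {g : Sph d → Amb d} {L M : ℝ}
    (hf : ∀ x, HasSphereGradientAt f (g x) x)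
    (hL : ∀ x x', ‖g x - g x'‖ ≤ L * ‖(x : Amb d) - x'‖) (hM : ∀ x, ‖g x‖ ≤ M)
    (hL0 : 0 ≤ L)
    (x : Sph d) (u : Amb d) (hu : ‖u‖ = 1) (hxu : inner ℝ (x : Amb d) u = 0)
    {T : ℝ} (hT : 0 ≤ T) :
    |f (greatCircle x u hu hxu T) - f x - T * inner ℝ (g x) u| ≤ (2 * L + 2 * M) * T * T := by
  have hM0 : 0 ≤ M := (norm_nonneg _).trans (hM x)
  set γ := greatCircle x u hu hxu with hγ
  set c : ℝ := inner ℝ (g x) u with hc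
  have hder : ∀ t : ℝ, HasDerivAt (fun s => f (γ s) - s * c)
      (inner ℝ (g (γ t)) ((-Real.sin t) • (x : Amb d) + Real.cos t • u) - c) t := by
    intro t
    have h2 : HasDerivAt (fun s : ℝ => s * c) c t := by
      simpa using (hasDerivAt_id t).mul_const c
    exact ((hf (γ t)).comp_hasDerivAt (hasDerivAt_greatCircle x u hu hxu t)).sub h2
  -- The derivative drifts from `c` because the tangent vector turns (at most `M * 2t`) and because
  -- the gradient changes (at most `L * 2t`).
  have hbound : ∀ t ∈ Ico (0 : ℝ) T,
      ‖inner ℝ (g (γ t)) ((-Real.sin t) • (x : Amb d) + Real.cos t • u) - c‖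
        ≤ (2 * L + 2 * M) * T := by
    intro t ht
    have e1 : ‖(γ t : Amb d) - x‖ ≤ 2 * t := by
      have : (γ t : Amb d) - x = (Real.cos t - 1) • (x : Amb d) + Real.sin t • u := by
        rw [hγ, coe_greatCircle, sub_smul, one_smul]; abel
      rw [this]
      refine (norm_add_le _ _).trans ?_
      rw [norm_smul, norm_smul, hu, norm_sph, Real.norm_eq_abs, Real.norm_eq_abs]
      linarith [abs_cos_sub_one_le ht.1, abs_sin_le_of_nonneg ht.1]
    have e2 : ‖(-Real.sin t) • (x : Amb d) + Real.cos t • u - u‖ ≤ 2 * t := by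
      have : (-Real.sin t) • (x : Amb d) + Real.cos t • u - u
          = (-Real.sin t) • (x : Amb d) + (Real.cos t - 1) • u := by
        rw [sub_smul, one_smul]; abel
      rw [this]
      refine (norm_add_le _ _).trans ?_
      rw [norm_smul, norm_smul, hu, norm_sph, Real.norm_eq_abs, Real.norm_eq_abs, abs_neg]
      linarith [abs_cos_sub_one_le ht.1, abs_sin_le_of_nonneg ht.1]
    have e3 : inner ℝ (g (γ t)) ((-Real.sin t) • (x : Amb d) + Real.cos t • u) - c
        = inner ℝ (g (γ t)) ((-Real.sin t) • (x : Amb d) + Real.cos t • u - u)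
          + inner ℝ (g (γ t) - g x) u := by
      rw [hc, inner_sub_right, inner_sub_left]; ring
    rw [e3]
    refine (norm_add_le _ _).trans ?_
    have e4 := norm_inner_le_norm (𝕜 := ℝ) (g (γ t))
      ((-Real.sin t) • (x : Amb d) + Real.cos t • u - u)
    have e5 := norm_inner_le_norm (𝕜 := ℝ) (g (γ t) - g x) u
    rw [hu, mul_one] at e5
    have e6 := mul_le_mul (hM (γ t)) e2 (norm_nonneg _) hM0
    have e7 := (hL (γ t) x).trans (mul_le_mul_of_nonneg_left e1 hL0)
    have e8 : (2 * L + 2 * M) * t ≤ (2 * L + 2 * M) * T :=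
      mul_le_mul_of_nonneg_left ht.2.le (by positivity)
    linarith
  have h := norm_image_sub_le_of_norm_deriv_le_segment' (f := fun s => f (γ s) - s * c)
    (fun t _ => (hder t).hasDerivWithinAt) hbound T (right_mem_Icc.2 hT)
  have h0 : γ 0 = x := by
    apply Subtype.ext
    rw [hγ, coe_greatCircle]; simp
  rw [Real.norm_eq_abs] at h
  simp only [h0, zero_mul, sub_zero] at h
  have e : f (γ T) - f x - T * c = f (γ T) - T * c - f x := by ring
  rw [e]
  exact h

/-- The tangential gradients of a continuous family of functions on the sphere with uniformly
Lipschitz gradients depend continuously on the parameter. -/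
theorem continuous_tangentProj_grad {Λ : Type*} [TopologicalSpace Λ] {f : Λ → Sph d → ℝ}
    {g : Λ → Sph d → Amb d} {L M : ℝ}
    (hf : ∀ l x, HasSphereGradientAt (f l) (g l x) x)
    (hL : ∀ l x x', ‖g l x - g l x'‖ ≤ L * ‖(x : Amb d) - x'‖) (hM : ∀ l x, ‖g l x‖ ≤ M)
    (hL0 : 0 ≤ L) (hcont : ∀ x, Continuous fun l => f l x) (x : Sph d) :
    Continuous fun l => tangentProj x (g l x) := by
  have hunit : ∀ u : Amb d, ‖u‖ = 1 → inner ℝ (x : Amb d) u = 0 →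
      Continuous fun l => inner ℝ (g l x) u := by
    intro u hu hxu
    -- Difference quotients along the great circle, with step `1 / (n + 1)`. The Taylor error
    -- divided by the step is `(2L + 2M) / (n + 1)`, uniformly in the parameter, so continuity
    -- passes to the limit.
    have hlim : TendstoUniformly
        (fun (n : ℕ) l => ((n : ℝ) + 1) * (f l (greatCircle x u hu hxu (1 / ((n : ℝ) + 1))) - f l x))
        (fun l => inner ℝ (g l x) u) atTop := by
      rw [Metric.tendstoUniformly_iff]
      intro ε hε
      have h0 : Tendsto (fun n : ℕ => (2 * L + 2 * M) * (1 / ((n : ℝ) + 1))) atTop (𝓝 0) := by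
        simpa using tendsto_one_div_add_atTop_nhds_zero_nat.const_mul (2 * L + 2 * M)
      filter_upwards [h0.eventually (gt_mem_nhds hε)] with n hn l
      have hn0 : (0 : ℝ) < (n : ℝ) + 1 := by positivity
      have h1 := abs_taylor_greatCircle_le (hf l) (hL l) (hM l) hL0 x u hu hxu
        (T := 1 / ((n : ℝ) + 1)) (by positivity)
      rw [dist_comm, Real.dist_eq]
      refine lt_of_le_of_lt ?_ hn
      have h2 : ((n : ℝ) + 1) * (f l (greatCircle x u hu hxu (1 / ((n : ℝ) + 1))) - f l x)
          - inner ℝ (g l x) u = ((n : ℝ) + 1) *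
            (f l (greatCircle x u hu hxu (1 / ((n : ℝ) + 1))) - f l x
              - 1 / ((n : ℝ) + 1) * inner ℝ (g l x) u) := by
        field_simp
      rw [h2, abs_mul, abs_of_pos hn0]
      refine (mul_le_mul_of_nonneg_left h1 hn0.le).trans (le_of_eq ?_)
      field_simp
    exact hlim.continuous (Frequently.of_forall fun n =>
      continuous_const.mul ((hcont _).sub (hcont _)))
  have hinner : ∀ e : Amb d, Continuous fun l => inner ℝ (g l x) (tangentProj x e) := by
    intro e
    by_cases h0 : tangentProj x e = 0
    · simp only [h0, inner_zero_right]; exact continuous_const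
    · have hpos : ‖tangentProj x e‖ ≠ 0 := norm_ne_zero_iff.2 h0
      have h1 := hunit (‖tangentProj x e‖⁻¹ • tangentProj x e)
        (by rw [norm_smul, norm_inv, norm_norm, inv_mul_cancel₀ hpos])
        (by rw [inner_smul_right, inner_tangentProj_self, mul_zero])
      have h2 := h1.const_mul ‖tangentProj x e‖
      refine h2.congr fun l => ?_
      rw [inner_smul_right, mul_inv_cancel_left₀ hpos]
  -- The projection is self-adjoint, so each coordinate of the projected gradient is a pairing of
  -- the gradient with a tangent vector.
  have hcoord : Continuous fun l => WithLp.ofLp (tangentProj x (g l x)) := by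
    refine continuous_pi fun i => ?_
    refine (hinner (EuclideanSpace.single i 1)).congr fun l => ?_
    rw [← inner_tangentProj_comm, EuclideanSpace.inner_single_right]
    simp
  exact (PiLp.continuous_toLp 2 _).comp hcoord

/-- The properties of the tangential interaction field `P_x^⊥ ∇_x h` used below. -/
structure IsTangentKernel (g : State d A → State d A → Amb d) (M L K : ℝ) : Prop where
  continuous : Continuous fun p : State d A × State d A => g p.1 p.2
  bound : ∀ z w, ‖g z w‖ ≤ M
  tangent : ∀ z w, inner ℝ (z.1 : Amb d) (g z w) = 0
  lip_fst : ∀ (x x' : Sph d) (ξ : A) (w : State d A),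
    ‖g (x, ξ) w - g (x', ξ) w‖ ≤ L * ‖(x : Amb d) - x'‖
  lip_snd : ∀ (z : State d A) (y y' : Sph d) (ζ : A),
    ‖g z (y, ζ) - g z (y', ζ)‖ ≤ K * ‖(y : Amb d) - y'‖
  M_nonneg : 0 ≤ M
  L_nonneg : 0 ≤ L
  K_nonneg : 0 ≤ K

/-- The interaction field `P_x^⊥ ∇_x h((x,ξ),w)`. -/
def tangentGrad (gradh : State d A → State d A → Amb d) (z w : State d A) : Amb d :=
  tangentProj z.1 (gradh z w)

theorem norm_tangentProj_sub_tangentProj_le (x y : Sph d) (v w : Amb d) :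
    ‖tangentProj x v - tangentProj y w‖ ≤ ‖v - w‖ + 2 * ‖w‖ * ‖(x : Amb d) - y‖ := by
  have h1 : tangentProj x v - tangentProj y w
      = tangentProj x (v - w) + (tangentProj x w - tangentProj y w) := by
    simp only [← tangentProjL_apply, map_sub]; abel
  rw [h1]
  exact (norm_add_le _ _).trans
    (add_le_add (norm_tangentProj_le _ _) (norm_tangentProj_sub_le _ _ _))

variable {h : State d A → State d A → ℝ} {gradh : State d A → State d A → Amb d} {Lx Mh Lμ : ℝ}

/-- The constants carry no sign assumption; the Lipschitz bounds evaluated at an antipodal pair,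
which has positive distance, make them nonnegative. -/
theorem sph_neg_ne (x : Sph d) : ‖(x : Amb d) - ((-x : Sph d) : Amb d)‖ = 2 := by
  have : (x : Amb d) - ((-x : Sph d) : Amb d) = (2 : ℝ) • (x : Amb d) := by
    rw [coe_neg_sphere, sub_neg_eq_add, two_smul]
  rw [this, norm_smul, norm_sph]; norm_num

theorem IsRegularKernel.Mh_nonneg (hreg : IsRegularKernel h gradh Lx Mh) (z : State d A) :
    0 ≤ Mh := (norm_nonneg _).trans (hreg.bounded_grad z z)

theorem IsRegularKernel.Lx_nonneg (hreg : IsRegularKernel h gradh Lx Mh) (z : State d A) :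
    0 ≤ Lx := by
  have := (norm_nonneg _).trans (hreg.lipschitz_grad z.1 (-z.1) z.2 z)
  rw [sph_neg_ne] at this
  linarith

theorem SecondArgLipschitz.nonneg (hs : SecondArgLipschitz gradh Lμ) (z : State d A) :
    0 ≤ Lμ := by
  have := (norm_nonneg _).trans (hs z z (-z.1, z.2))
  rw [dX, sph_neg_ne, dist_self] at this
  linarith

theorem IsRegularKernel.norm_tangentGrad_sub_le (hreg : IsRegularKernel h gradh Lx Mh)
    (x x' : Sph d) (ξ : A) (w : State d A) :
    ‖tangentGrad gradh (x, ξ) w - tangentGrad gradh (x', ξ) w‖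
      ≤ (Lx + 2 * Mh) * ‖(x : Amb d) - x'‖ := by
  refine (norm_tangentProj_sub_tangentProj_le _ _ _ _).trans ?_
  have h1 := hreg.lipschitz_grad x x' ξ w
  have h2 := mul_le_mul_of_nonneg_right (hreg.bounded_grad (x', ξ) w)
    (norm_nonneg ((x : Amb d) - x'))
  simp only
  nlinarith

theorem SecondArgLipschitz.norm_tangentGrad_sub_le (hs : SecondArgLipschitz gradh Lμ)
    (z w w' : State d A) :
    ‖tangentGrad gradh z w - tangentGrad gradh z w'‖ ≤ Lμ * dX w w' := by
  have : tangentGrad gradh z w - tangentGrad gradh z w'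
      = tangentProj z.1 (gradh z w - gradh z w') := by
    simp only [tangentGrad, ← tangentProjL_apply, map_sub]
  rw [this]
  exact (norm_tangentProj_le _ _).trans (hs z w w')

/-- The issue is joint continuity: `IsRegularKernel` and (a) say nothing direct about `gradh` as a
function of its first label. Only the tangential part of the gradient is determined by `h`, and it
inherits continuity in that label from `h`; in the other variables it is Lipschitz, uniformly in the
label. -/
theorem IsRegularKernel.isTangentKernel (hreg : IsRegularKernel h gradh Lx Mh)
    (hs : SecondArgLipschitz gradh Lμ) (z₀ : State d A) :
    IsTangentKernel (tangentGrad gradh) Mh (Lx + 2 * Mh) Lμ := by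
  have hM := hreg.Mh_nonneg z₀
  have hL := hreg.Lx_nonneg z₀
  have hK := hs.nonneg z₀
  refine ⟨?_, fun z w => (norm_tangentProj_le _ _).trans (hreg.bounded_grad z w),
    fun z w => inner_tangentProj_self _ _, hreg.norm_tangentGrad_sub_le, fun z y y' ζ => ?_,
    hM, by positivity, hK⟩
  · have hξ : ∀ (x : Sph d) (w : State d A), Continuous fun ξ => tangentGrad gradh (x, ξ) w := by
      intro x w
      exact continuous_tangentProj_grad (f := fun ξ x' => h (x', ξ) w)
        (g := fun ξ x' => gradh (x', ξ) w) (fun ξ x' => hreg.hasGradient x' ξ w)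
        (fun ξ x' x'' => hreg.lipschitz_grad x' x'' ξ w) (fun ξ x' => hreg.bounded_grad _ _) hL
        (fun x' => hreg.continuous.comp (f := fun ξ => ((x', ξ), w)) (by fun_prop)) x
    have hjoint : Continuous fun p : (Sph d × State d A) × A =>
        tangentGrad gradh (p.1.1, p.2) p.1.2 := by
      -- The factor 2 in front of `Lμ` appears because products carry the maximum metric, while `dX`
      -- is a sum.
      refine continuous_prod_of_continuous_lipschitzWith _
        (Real.toNNReal ((Lx + 2 * Mh) + 2 * Lμ)) (fun a => hξ a.1 a.2) fun ξ => ?_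
      refine LipschitzWith.of_dist_le_mul fun a b => ?_
      rw [Real.coe_toNNReal _ (by positivity), dist_eq_norm]
      have h1 := hreg.norm_tangentGrad_sub_le a.1 b.1 ξ a.2
      have h2 := hs.norm_tangentGrad_sub_le (b.1, ξ) a.2 b.2
      have h3 := norm_sub_le_norm_sub_add_norm_sub (tangentGrad gradh (a.1, ξ) a.2)
        (tangentGrad gradh (b.1, ξ) a.2) (tangentGrad gradh (b.1, ξ) b.2)
      have d1 : ‖(a.1 : Amb d) - b.1‖ ≤ dist a b := by
        rw [← dist_eq_norm]; exact le_max_left _ _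
      have d2 : dX a.2 b.2 ≤ 2 * dist a b := by
        have e1 : ‖(a.2.1 : Amb d) - b.2.1‖ ≤ dist a b := by
          rw [← dist_eq_norm]; exact (le_max_left _ _).trans (le_max_right _ _)
        have e2 : dist a.2.2 b.2.2 ≤ dist a b := (le_max_right _ _).trans (le_max_right _ _)
        rw [dX]; linarith
      have h4 := mul_le_mul_of_nonneg_left d1 (show 0 ≤ Lx + 2 * Mh by positivity)
      have h5 := mul_le_mul_of_nonneg_left d2 hK
      linarith
    exact hjoint.comp (f := fun p : State d A × State d A => ((p.1.1, p.2), p.1.2)) (by fun_prop)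
  · refine (hs.norm_tangentGrad_sub_le _ _ _).trans (le_of_eq ?_)
    simp [dX]

end Kernel

/-! ### Radial extension from the sphere to the ambient space -/

section RadialExtension

variable {d : ℕ} {E : Type*} [NormedAddCommGroup E] [NormedSpace ℝ E]

/-- The extension `x ↦ min(‖x‖,1) φ(x/‖x‖)` of a function on the sphere to the ambient space. -/
def radialExt (φ : Sph d → E) (x : Amb d) : E :=
  if hx : x = 0 then 0 else
    (min ‖x‖ 1) • φ ⟨‖x‖⁻¹ • x, by
      rw [mem_sphere_zero_iff_norm, norm_smul, norm_inv, norm_norm,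
        inv_mul_cancel₀ (norm_ne_zero_iff.2 hx)]⟩

theorem radialExt_zero (φ : Sph d → E) : radialExt φ 0 = 0 := by simp [radialExt]

/-- The point `y` is chosen before `φ`, so extensions of different functions can be compared at the
same point of the sphere. -/
theorem radialExt_of_ne (E : Type*) [NormedAddCommGroup E] [NormedSpace ℝ E] {x : Amb d} (hx : x ≠ 0) :
    ∃ y : Sph d, (y : Amb d) = ‖x‖⁻¹ • x ∧ ∀ φ : Sph d → E,
      radialExt φ x = (min ‖x‖ 1) • φ y :=
  ⟨⟨‖x‖⁻¹ • x, by
      rw [mem_sphere_zero_iff_norm, norm_smul, norm_inv, norm_norm,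
        inv_mul_cancel₀ (norm_ne_zero_iff.2 hx)]⟩, rfl, fun φ => by rw [radialExt, dif_neg hx]⟩

/-- `radialExt` evaluates a function at one point and scales the value. -/
theorem exists_radialExt_eq [Nonempty (Sph d)] (E : Type*) [NormedAddCommGroup E]
    [NormedSpace ℝ E] (x : Amb d) :
    ∃ (y : Sph d) (s : ℝ), ∀ φ : Sph d → E, radialExt φ x = s • φ y := by
  by_cases hx : x = 0
  · obtain ⟨y⟩ := ‹Nonempty (Sph d)›
    exact ⟨y, 0, fun φ => by simp [hx, radialExt_zero]⟩
  · obtain ⟨y, -, hφ⟩ := radialExt_of_ne E hx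
    exact ⟨y, min ‖x‖ 1, hφ⟩

theorem radialExt_coe (φ : Sph d → E) (x : Sph d) : radialExt φ (x : Amb d) = φ x := by
  have hx : (x : Amb d) ≠ 0 := by
    rw [← norm_ne_zero_iff, norm_sph]; exact one_ne_zero
  obtain ⟨y, hy, hφ⟩ := radialExt_of_ne E hx
  rw [norm_sph, inv_one, one_smul] at hy
  rw [hφ, norm_sph, min_self, one_smul, Subtype.ext hy]

theorem norm_radialExt_le {φ : Sph d → E} {M : ℝ} (hM0 : 0 ≤ M) (hM : ∀ x, ‖φ x‖ ≤ M)
    (x : Amb d) : ‖radialExt φ x‖ ≤ M := by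
  by_cases hx : x = 0
  · simpa [hx, radialExt_zero]
  · obtain ⟨y, -, hφ⟩ := radialExt_of_ne E hx
    rw [hφ, norm_smul, Real.norm_of_nonneg (by positivity)]
    exact (mul_le_mul (min_le_right _ _) (hM y) (norm_nonneg _) zero_le_one).trans
      (one_mul M).le

theorem radialExt_sub (φ ψ : Sph d → E) (x : Amb d) :
    radialExt φ x - radialExt ψ x = radialExt (fun y => φ y - ψ y) x := by
  by_cases hx : x = 0
  · simp [hx, radialExt_zero]
  · obtain ⟨y, -, hφ⟩ := radialExt_of_ne E hx
    rw [hφ, hφ, hφ, smul_sub]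

/-- The radial factor `min ‖x‖ 1` is 1-Lipschitz and contributes `M`. Normalisation is not Lipschitz
near the origin, but there the radial factor compensates: `‖y‖ * ‖x/‖x‖ - y/‖y‖‖ ≤ 2 ‖x - y‖`, which
contributes `2 * L`. -/
theorem norm_radialExt_sub_le {φ : Sph d → E} {M L : ℝ} (hM : ∀ x, ‖φ x‖ ≤ M) (hL0 : 0 ≤ L)
    (hL : ∀ x x', ‖φ x - φ x'‖ ≤ L * ‖(x : Amb d) - x'‖) (x y : Amb d) :
    ‖radialExt φ x - radialExt φ y‖ ≤ (M + 2 * L) * ‖x - y‖ := by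
  have hzero : ∀ x : Amb d, ‖radialExt φ x‖ ≤ (M + 2 * L) * ‖x‖ := by
    intro x
    by_cases hx : x = 0
    · simp [hx, radialExt_zero]
    · obtain ⟨y, -, hφ⟩ := radialExt_of_ne E hx
      have hM0 : 0 ≤ M := (norm_nonneg _).trans (hM y)
      rw [hφ, norm_smul, Real.norm_of_nonneg (by positivity), mul_comm (M + 2 * L)]
      exact mul_le_mul (min_le_left _ _) ((hM y).trans (by linarith)) (norm_nonneg _)
        (norm_nonneg _)
  by_cases hx : x = 0
  · simpa [hx, radialExt_zero] using hzero y
  by_cases hy : y = 0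
  · simpa [hy, radialExt_zero] using hzero x
  obtain ⟨x', hx', hφx⟩ := radialExt_of_ne E hx
  obtain ⟨y', hy', hφy⟩ := radialExt_of_ne E hy
  have hxp : 0 < ‖x‖ := norm_pos_iff.2 hx
  have hM0 : 0 ≤ M := (norm_nonneg _).trans (hM y')
  have h1 : (min ‖x‖ 1) • φ x' - (min ‖y‖ 1) • φ y'
      = (min ‖x‖ 1 - min ‖y‖ 1) • φ x' + (min ‖y‖ 1) • (φ x' - φ y') := by
    rw [sub_smul, smul_sub]; abel
  have h2 : ‖y‖ * ‖(x' : Amb d) - y'‖ ≤ 2 * ‖x - y‖ := by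
    have e : ‖y‖ • ((x' : Amb d) - y') = (‖y‖ - ‖x‖) • (x' : Amb d) + (x - y) := by
      have ex : x = ‖x‖ • (x' : Amb d) := by
        rw [hx', smul_smul, mul_inv_cancel₀ hxp.ne', one_smul]
      have ey : y = ‖y‖ • (y' : Amb d) := by
        rw [hy', smul_smul, mul_inv_cancel₀ (norm_ne_zero_iff.2 hy), one_smul]
      have : (x - y) = ‖x‖ • (x' : Amb d) - ‖y‖ • (y' : Amb d) := by rw [← ex, ← ey]
      rw [this, smul_sub, sub_smul]; abel
    have e2 := norm_add_le ((‖y‖ - ‖x‖) • (x' : Amb d)) (x - y)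
    rw [← e, norm_smul, norm_norm, norm_smul, norm_sph, mul_one, Real.norm_eq_abs] at e2
    have e3 := abs_norm_sub_norm_le y x
    rw [norm_sub_rev] at e3
    linarith
  have h3 : |min ‖x‖ 1 - min ‖y‖ 1| ≤ ‖x - y‖ :=
    (abs_min_sub_min_le_max _ _ _ _).trans (by simpa using abs_norm_sub_norm_le x y)
  rw [hφx, hφy, h1]
  refine (norm_add_le _ _).trans ?_
  rw [norm_smul, norm_smul, Real.norm_eq_abs, Real.norm_of_nonneg (by positivity : 0 ≤ min ‖y‖ 1)]
  have h4 : |min ‖x‖ 1 - min ‖y‖ 1| * ‖φ x'‖ ≤ ‖x - y‖ * M :=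
    mul_le_mul h3 (hM _) (norm_nonneg _) (norm_nonneg _)
  have h5 : min ‖y‖ 1 * ‖φ x' - φ y'‖ ≤ ‖y‖ * (L * ‖(x' : Amb d) - y'‖) :=
    mul_le_mul (min_le_left _ _) (hL _ _) (norm_nonneg _) (norm_nonneg _)
  nlinarith [mul_le_mul_of_nonneg_left h2 hL0]

end RadialExtension

/-! ### Integrability, and the velocity as an integral of the tangential kernel -/

section Integrals

variable {d : ℕ} {A : Type*} [MetricSpace A] [CompactSpace A] [MeasurableSpace A] [BorelSpace A]

theorem integrable_of_continuous {E : Type*} [NormedAddCommGroup E] {f : State d A → E}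
    (hf : Continuous f) (μ : Measure (State d A)) [IsFiniteMeasure μ] : Integrable f μ :=
  hf.integrable_of_hasCompactSupport (HasCompactSupport.of_compactSpace f)

variable {gradh : State d A → State d A → Amb d} {Lμ : ℝ}

theorem SecondArgLipschitz.continuous (hs : SecondArgLipschitz gradh Lμ) (z : State d A) :
    Continuous (gradh z) := by
  have hLμ := hs.nonneg z
  have : LipschitzWith (Real.toNNReal (2 * Lμ)) (gradh z) := by
    refine LipschitzWith.of_dist_le_mul fun a b => ?_
    rw [Real.coe_toNNReal _ (by positivity), dist_eq_norm]
    refine (hs z a b).trans ?_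
    have e1 : ‖(a.1 : Amb d) - b.1‖ ≤ dist a b := by
      rw [← dist_eq_norm]; exact le_max_left _ _
    have e2 : dist a.2 b.2 ≤ dist a b := le_max_right _ _
    rw [dX]
    nlinarith
  exact this.continuous

theorem velocity_eq_integral_tangentGrad (hs : SecondArgLipschitz gradh Lμ)
    (μ : Measure (State d A)) [IsFiniteMeasure μ] (z : State d A) :
    velocity gradh μ z = ∫ w, tangentGrad gradh z w ∂μ := by
  simp only [velocity, tangentGrad, ← tangentProjL_apply]
  exact ((tangentProjL z.1).integral_comp_comm
    (integrable_of_continuous (hs.continuous z) μ)).symm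

end Integrals

/-! ### The kernel extended to the ambient space -/

section AmbientKernel

variable {d : ℕ} {A : Type*} [MetricSpace A] {g : State d A → State d A → Amb d} {M L K : ℝ}

/-- Extension of a kernel on the state space to the ambient space in both content variables. -/
def ambientKernel (g : State d A → State d A → Amb d) (p q : Amb d × A) : Amb d :=
  radialExt (fun x : Sph d => radialExt (fun y : Sph d => g (x, p.2) (y, q.2)) q.1) p.1

/-- The inclusion of the state space in the ambient space. -/
def toAmb (z : State d A) : Amb d × A := (z.1, z.2)

theorem continuous_toAmb : Continuous (toAmb : State d A → Amb d × A) := by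
  unfold toAmb; fun_prop

theorem ambientKernel_toAmb (g : State d A → State d A → Amb d) (z w : State d A) :
    ambientKernel g (toAmb z) (toAmb w) = g z w := by
  simp [ambientKernel, toAmb, radialExt_coe]

namespace IsTangentKernel

theorem norm_ambientKernel_le (hg : IsTangentKernel g M L K) (p q : Amb d × A) :
    ‖ambientKernel g p q‖ ≤ M :=
  norm_radialExt_le hg.M_nonneg (fun _ => norm_radialExt_le hg.M_nonneg (fun _ => hg.bound _ _) _) _

/-- The extension only rescales values along rays, so it stays orthogonal to the position; hence the
extended dynamics conserve `‖x‖`. -/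
theorem inner_ambientKernel (hg : IsTangentKernel g M L K) (p q : Amb d × A) :
    inner ℝ p.1 (ambientKernel g p q) = 0 := by
  by_cases hp : p.1 = 0
  · simp [hp]
  · obtain ⟨x, hx, hφ⟩ := radialExt_of_ne (Amb d) hp
    have : Nonempty (Sph d) := ⟨x⟩
    obtain ⟨y, s, hψ⟩ := exists_radialExt_eq (Amb d) q.1
    have hpx : p.1 = ‖p.1‖ • (x : Amb d) := by
      rw [hx, smul_smul, mul_inv_cancel₀ (norm_ne_zero_iff.2 hp), one_smul]
    rw [ambientKernel, hφ, hψ, hpx, inner_smul_left, inner_smul_right, inner_smul_right]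
    have := hg.tangent (x, p.2) (y, q.2)
    simp only at this
    rw [this]; simp

theorem lip_fst_ambientKernel (hg : IsTangentKernel g M L K) (x x' : Amb d) (ξ : A)
    (q : Amb d × A) :
    ‖ambientKernel g (x, ξ) q - ambientKernel g (x', ξ) q‖ ≤ (M + 2 * L) * ‖x - x'‖ := by
  refine norm_radialExt_sub_le (fun _ => norm_radialExt_le hg.M_nonneg (fun _ => hg.bound _ _) _)
    hg.L_nonneg (fun y y' => ?_) _ _
  rw [radialExt_sub]
  exact norm_radialExt_le (mul_nonneg hg.L_nonneg (norm_nonneg _)) (fun _ => hg.lip_fst _ _ _ _) _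

theorem lip_snd_ambientKernel (hg : IsTangentKernel g M L K) (p : Amb d × A) (y y' : Amb d)
    (ζ : A) :
    ‖ambientKernel g p (y, ζ) - ambientKernel g p (y', ζ)‖ ≤ (M + 2 * K) * ‖y - y'‖ := by
  rw [ambientKernel, ambientKernel, radialExt_sub]
  have := hg.M_nonneg
  have := hg.K_nonneg
  exact norm_radialExt_le (by positivity) (fun x => norm_radialExt_sub_le (fun _ => hg.bound _ _)
    hg.K_nonneg (fun y y' => hg.lip_snd _ _ _ _) _ _) _

theorem continuous_ambientKernel [Nonempty (Sph d)] (hg : IsTangentKernel g M L K) :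
    Continuous fun r : (Amb d × A) × (Amb d × A) => ambientKernel g r.1 r.2 := by
  have := hg.M_nonneg
  have := hg.K_nonneg
  have := hg.L_nonneg
  have hjoint : Continuous fun r : (Amb d × Amb d) × (A × A) =>
      ambientKernel g (r.1.1, r.2.1) (r.1.2, r.2.2) := by
    refine continuous_prod_of_continuous_lipschitzWith _
      (Real.toNNReal ((M + 2 * L) + (M + 2 * K))) (fun a => ?_) fun b => ?_
    · obtain ⟨x, s, hx⟩ := exists_radialExt_eq (Amb d) a.1
      obtain ⟨y, r, hy⟩ := exists_radialExt_eq (Amb d) a.2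
      simp only [ambientKernel, hx, hy]
      have := hg.continuous.comp (f := fun b : A × A => ((x, b.1), (y, b.2))) (by fun_prop)
      exact (this.const_smul r).const_smul s
    · refine LipschitzWith.of_dist_le_mul fun a a' => ?_
      rw [Real.coe_toNNReal _ (by positivity), dist_eq_norm]
      have h1 := hg.lip_fst_ambientKernel a.1 a'.1 b.1 (a.2, b.2)
      have h2 := hg.lip_snd_ambientKernel (a'.1, b.1) a.2 a'.2 b.2
      have h3 := norm_sub_le_norm_sub_add_norm_sub (ambientKernel g (a.1, b.1) (a.2, b.2))
        (ambientKernel g (a'.1, b.1) (a.2, b.2)) (ambientKernel g (a'.1, b.1) (a'.2, b.2))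
      have d1 : ‖a.1 - a'.1‖ ≤ dist a a' := by rw [← dist_eq_norm]; exact le_max_left _ _
      have d2 : ‖a.2 - a'.2‖ ≤ dist a a' := by rw [← dist_eq_norm]; exact le_max_right _ _
      have h4 := mul_le_mul_of_nonneg_left d1 (show 0 ≤ M + 2 * L by positivity)
      have h5 := mul_le_mul_of_nonneg_left d2 (show 0 ≤ M + 2 * K by positivity)
      linarith
  exact hjoint.comp (f := fun r : (Amb d × A) × (Amb d × A) => ((r.1.1, r.2.1), (r.1.2, r.2.2)))
    (by fun_prop)

end IsTangentKernel

end AmbientKernel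

/-! ### Global integral curves of bounded Lipschitz fields -/

section GlobalODE

variable {E : Type*} [NormedAddCommGroup E] [NormedSpace ℝ E]

/-- A bounded, globally Lipschitz vector field on a Banach space has global integral curves. -/
theorem exists_global_integralCurve [CompleteSpace E] {F : E → E} {K M : ℝ≥0}
    (hK : LipschitzWith K F) (hM : ∀ x, ‖F x‖ ≤ M) (x₀ : E) :
    ∃ α : ℝ → E, α 0 = x₀ ∧ ∀ t, HasDerivAt α (F (α t)) t := by
  have hloc : ∀ n : ℕ, ∃ α : ℝ → E, α 0 = x₀ ∧
      ∀ t ∈ Ioo (-(n : ℝ) - 1) (n + 1), HasDerivAt α (F (α t)) t := by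
    intro n
    have hn : (0 : ℝ) ≤ n := n.cast_nonneg
    -- Since `F` is bounded by `M` everywhere, a ball of radius `M * (n + 1)` cannot be left within
    -- time `n + 1`, so the local theorem applies on an interval of any length.
    have hpl : IsPicardLindelof (fun _ => F) (tmin := -(n : ℝ) - 1) (tmax := n + 1)
        ⟨0, by constructor <;> linarith⟩ x₀ (M * (n + 1)) 0 M K := by
      refine ⟨fun _ _ => hK.lipschitzOnWith, fun _ _ => continuousOn_const,
        fun _ _ x _ => hM x, ?_⟩
      have : max ((n : ℝ) + 1 - 0) (0 - (-(n : ℝ) - 1)) = n + 1 := by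
        rw [sub_zero, zero_sub, neg_sub, sub_neg_eq_add, add_comm (1 : ℝ), max_self]
      rw [this]
      simp
    obtain ⟨α, h0, hα⟩ := IsPicardLindelof.exists_eq_forall_mem_Icc_hasDerivWithinAt₀ hpl
    exact ⟨α, h0, fun t ht => (hα t (Ioo_subset_Icc_self ht)).hasDerivAt (Icc_mem_nhds ht.1 ht.2)⟩
  choose α h0 hα using hloc
  have hagree : ∀ m n : ℕ, m ≤ n → EqOn (α m) (α n) (Ioo (-(m : ℝ) - 1) (m + 1)) := by
    intro m n hmn
    have hmn' : (m : ℝ) ≤ n := by exact_mod_cast hmn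
    have hm : (0 : ℝ) ≤ m := m.cast_nonneg
    exact ODE_solution_unique_of_mem_Ioo (v := fun _ => F) (s := fun _ => univ) (t₀ := 0)
      (fun _ _ => hK.lipschitzOnWith) (by constructor <;> linarith)
      (fun t ht => ⟨hα m t ht, mem_univ _⟩)
      (fun t ht => ⟨hα n t ⟨by linarith [ht.1], by linarith [ht.2]⟩, mem_univ _⟩)
      ((h0 m).trans (h0 n).symm)
  -- The curve with index `n` lives on `(-n - 1, n + 1)`, one unit beyond `|t| ≤ n`, so each `t` is
  -- interior to the interval of its own curve.
  refine ⟨fun t => α ⌈|t|⌉₊ t, by simpa using h0 0, fun t => ?_⟩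
  have ht : |t| ≤ ⌈|t|⌉₊ := Nat.le_ceil _
  have htm : t ∈ Ioo (-((⌈|t|⌉₊ : ℕ) : ℝ) - 1) ((⌈|t|⌉₊ : ℕ) + 1) :=
    ⟨by linarith [neg_abs_le t], by linarith [le_abs_self t]⟩
  refine (hα _ t htm).congr_of_eventuallyEq ?_
  filter_upwards [Ioo_mem_nhds htm.1 htm.2] with s hs
  have hsm : s ∈ Ioo (-((⌈|s|⌉₊ : ℕ) : ℝ) - 1) ((⌈|s|⌉₊ : ℕ) + 1) := by
    have := Nat.le_ceil |s|
    exact ⟨by linarith [neg_abs_le s], by linarith [le_abs_self s]⟩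
  rcases le_total ⌈|s|⌉₊ ⌈|t|⌉₊ with hle | hle
  · exact hagree _ _ hle hsm
  · exact (hagree _ _ hle hs).symm

theorem norm_integralCurve_sub_le {F : E → E} {M : ℝ} (hM : ∀ x, ‖F x‖ ≤ M) {α : ℝ → E}
    (hα : ∀ t, HasDerivAt α (F (α t)) t) {t ε : ℝ} (hε : 0 ≤ ε) :
    ‖α (t + ε) - α t‖ ≤ M * ε := by
  have h := norm_image_sub_le_of_norm_deriv_le_segment' (f := α) (a := t) (b := t + ε)
    (fun s _ => (hα s).hasDerivWithinAt) (fun s _ => hM (α s)) (t + ε)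
    (right_mem_Icc.2 (by linarith))
  simpa using h

/-- Applied in `C(X, ℝ^d)` with the sup norm, this makes the Euler remainder of the flow uniform in
the initial point. -/
theorem norm_integralCurve_sub_sub_le {F : E → E} {K : ℝ≥0} {M : ℝ} (hK : LipschitzWith K F)
    (hM : ∀ x, ‖F x‖ ≤ M) {α : ℝ → E} (hα : ∀ t, HasDerivAt α (F (α t)) t) {t ε : ℝ}
    (hε : 0 ≤ ε) : ‖α (t + ε) - α t - ε • F (α t)‖ ≤ K * M * ε ^ 2 := by
  have hM0 : 0 ≤ M := (norm_nonneg _).trans (hM (α t))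
  have h := norm_image_sub_le_of_norm_deriv_le_segment' (f := fun s => α s - s • F (α t))
    (f' := fun s => F (α s) - F (α t)) (C := K * M * ε) (a := t) (b := t + ε)
    (fun s _ => by
      have h2 : HasDerivAt (fun s : ℝ => s • F (α t)) (F (α t)) s := by
        simpa using (hasDerivAt_id s).smul_const (F (α t))
      exact ((hα s).sub h2).hasDerivWithinAt)
    (fun s hs => by
      have h1 := hK.dist_le_mul (α s) (α t)
      have h2 := norm_integralCurve_sub_le hM hα (t := t) (ε := s - t) (by linarith [hs.1])
      rw [add_sub_cancel] at h2
      rw [dist_eq_norm, dist_eq_norm] at h1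
      have h3 : M * (s - t) ≤ M * ε := mul_le_mul_of_nonneg_left (by linarith [hs.2]) hM0
      calc _ ≤ K * ‖α s - α t‖ := h1
        _ ≤ K * (M * ε) := mul_le_mul_of_nonneg_left (h2.trans h3) K.2
        _ = _ := by ring) (t + ε) (right_mem_Icc.2 (by linarith))
  have e : α (t + ε) - α t - ε • F (α t)
      = α (t + ε) - (t + ε) • F (α t) - (α t - t • F (α t)) := by rw [add_smul]; abel
  rw [e]
  refine h.trans (le_of_eq ?_)
  ring

end GlobalODE

/-! ### The nonlinear flow as an ODE on `C(X, ℝ^d)` -/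

section Flow

variable {d : ℕ} {A : Type*} [MetricSpace A] [CompactSpace A] [MeasurableSpace A] [BorelSpace A]
  {g : State d A → State d A → Amb d} {M L K : ℝ}

theorem nonempty_sph (μ₀ : ProbabilityMeasure (State d A)) : Nonempty (Sph d) :=
  μ₀.nonempty.map Prod.fst

/-- The vector field on `C(X, ℝ^d)` whose integral curves are the flow maps of the nonlinear
equation with initial law `μ₀`. -/
def flowField (hg : IsTangentKernel g M L K) (μ₀ : ProbabilityMeasure (State d A))
    (Φ : C(State d A, Amb d)) : C(State d A, Amb d) where
  toFun z := ∫ w, ambientKernel g (Φ z, z.2) (Φ w, w.2) ∂(μ₀ : Measure (State d A))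
  continuous_toFun := by
    have := nonempty_sph μ₀
    have hc := hg.continuous_ambientKernel.comp
      (f := fun p : State d A × State d A => ((Φ p.1, p.1.2), (Φ p.2, p.2.2))) (by fun_prop)
    refine continuous_of_dominated (bound := fun _ => M) (fun z => ?_) (fun z => ?_)
      (integrable_const _) (ae_of_all _ fun w => ?_)
    · exact (integrable_of_continuous (hc.comp (f := fun w => (z, w)) (by fun_prop))
        _).aestronglyMeasurable
    · exact ae_of_all _ fun w => hg.norm_ambientKernel_le _ _
    · exact hc.comp (f := fun z => (z, w)) (by fun_prop)

theorem flowField_apply (hg : IsTangentKernel g M L K) (μ₀ : ProbabilityMeasure (State d A))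
    (Φ : C(State d A, Amb d)) (z : State d A) : flowField hg μ₀ Φ z
      = ∫ w, ambientKernel g (Φ z, z.2) (Φ w, w.2) ∂(μ₀ : Measure (State d A)) := rfl

theorem integrable_ambientKernel (hg : IsTangentKernel g M L K)
    (μ₀ : ProbabilityMeasure (State d A)) (p : Amb d × A) {Ψ : State d A → Amb d × A}
    (hΨ : Continuous Ψ) :
    Integrable (fun w => ambientKernel g p (Ψ w)) (μ₀ : Measure (State d A)) := by
  have := nonempty_sph μ₀
  exact integrable_of_continuous (hg.continuous_ambientKernel.comp (continuous_const.prodMk hΨ)) _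

theorem norm_flowField_le (hg : IsTangentKernel g M L K) (μ₀ : ProbabilityMeasure (State d A))
    (Φ : C(State d A, Amb d)) : ‖flowField hg μ₀ Φ‖ ≤ M := by
  refine (ContinuousMap.norm_le _ hg.M_nonneg).2 fun z => ?_
  refine (norm_integral_le_of_norm_le_const (ae_of_all _ fun w =>
    hg.norm_ambientKernel_le _ _)).trans (by simp)

theorem lipschitzWith_flowField (hg : IsTangentKernel g M L K)
    (μ₀ : ProbabilityMeasure (State d A)) :
    LipschitzWith (Real.toNNReal ((M + 2 * L) + (M + 2 * K))) (flowField hg μ₀) := by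
  have hM := hg.M_nonneg
  have hL := hg.L_nonneg
  have hK := hg.K_nonneg
  refine LipschitzWith.of_dist_le_mul fun Φ Ψ => ?_
  rw [Real.coe_toNNReal _ (by positivity), dist_eq_norm]
  refine (ContinuousMap.norm_le _ (by positivity)).2 fun z => ?_
  rw [ContinuousMap.sub_apply, flowField_apply, flowField_apply, ← integral_sub
    (integrable_ambientKernel hg μ₀ _ (by fun_prop)) (integrable_ambientKernel hg μ₀ _ (by fun_prop))]
  refine (norm_integral_le_of_norm_le_const (C := ((M + 2 * L) + (M + 2 * K)) * dist Φ Ψ)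
    (ae_of_all _ fun w => ?_)).trans (by simp)
  have h1 := hg.lip_fst_ambientKernel (Φ z) (Ψ z) z.2 (Φ w, w.2)
  have h2 := hg.lip_snd_ambientKernel (Ψ z, z.2) (Φ w) (Ψ w) w.2
  have h3 := norm_sub_le_norm_sub_add_norm_sub (ambientKernel g (Φ z, z.2) (Φ w, w.2))
    (ambientKernel g (Ψ z, z.2) (Φ w, w.2)) (ambientKernel g (Ψ z, z.2) (Ψ w, w.2))
  have d1 : ‖Φ z - Ψ z‖ ≤ dist Φ Ψ := by rw [← dist_eq_norm]; exact ContinuousMap.dist_apply_le_dist z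
  have d2 : ‖Φ w - Ψ w‖ ≤ dist Φ Ψ := by rw [← dist_eq_norm]; exact ContinuousMap.dist_apply_le_dist w
  have h4 := mul_le_mul_of_nonneg_left d1 (show 0 ≤ M + 2 * L by positivity)
  have h5 := mul_le_mul_of_nonneg_left d2 (show 0 ≤ M + 2 * K by positivity)
  linarith

/-- A flow of the nonlinear equation with initial law `μ₀`, with a second order remainder
estimate that is uniform in the initial point. -/
structure IsFlow (g : State d A → State d A → Amb d) (μ₀ : ProbabilityMeasure (State d A))
    (Φ : ℝ → State d A → State d A) (C : ℝ) : Prop where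
  continuous : ∀ t, Continuous (Φ t)
  zero : ∀ z, Φ 0 z = z
  label : ∀ t z, (Φ t z).2 = z.2
  hasDerivAt : ∀ t z, HasDerivAt (fun s => ((Φ s z).1 : Amb d))
    (∫ w, g (Φ t z) (Φ t w) ∂(μ₀ : Measure (State d A))) t
  remainder : ∀ t z ε, 0 ≤ ε → ‖((Φ (t + ε) z).1 : Amb d) - (Φ t z).1
    - ε • ∫ w, g (Φ t z) (Φ t w) ∂(μ₀ : Measure (State d A))‖ ≤ C * ε ^ 2
  C_nonneg : 0 ≤ C

theorem exists_isFlow (hg : IsTangentKernel g M L K) (μ₀ : ProbabilityMeasure (State d A)) :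
    ∃ (Φ : ℝ → State d A → State d A) (C : ℝ), IsFlow g μ₀ Φ C := by
  have hM := hg.M_nonneg
  obtain ⟨α, h0, hα⟩ := exists_global_integralCurve (M := ⟨M, hM⟩) (lipschitzWith_flowField hg μ₀)
    (norm_flowField_le hg μ₀) ⟨fun z => (z.1 : Amb d), by fun_prop⟩
  have hα' : ∀ t z, HasDerivAt (fun s => α s z) (flowField hg μ₀ (α t) z) t := by
    intro t z
    have := (ContinuousMap.evalCLM ℝ z).hasFDerivAt.comp_hasDerivAt t (hα t)
    simpa [Function.comp_def] using this
  -- The derivative of `‖α s z‖ ^ 2` is `2⟨α, ∫ kernel⟩ = 0` by tangency of the extended kernel, and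
  -- the initial norm is 1.
  have hsph : ∀ t z, ‖α t z‖ = 1 := by
    intro t z
    have hd : ∀ s, HasDerivAt (fun s => ‖α s z‖ ^ 2) 0 s := by
      intro s
      have h1 := (hα' s z).norm_sq
      convert h1 using 1
      rw [flowField_apply, ← integral_inner
        (integrable_ambientKernel hg μ₀ _ (by fun_prop))]
      simp [hg.inner_ambientKernel (α s z, z.2)]
    have hconst := is_const_of_deriv_eq_zero (fun s => (hd s).differentiableAt)
      (fun s => (hd s).deriv) t 0
    have hz : α 0 z = (z.1 : Amb d) := by rw [h0]; rfl
    simp only [hz, norm_sph, one_pow] at hconst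
    exact (pow_eq_one_iff_of_nonneg (norm_nonneg _) two_ne_zero).1 hconst
  set Φ : ℝ → State d A → State d A :=
    fun t z => (⟨α t z, mem_sphere_zero_iff_norm.2 (hsph t z)⟩, z.2) with hΦ
  -- The curve never leaves the sphere, so the extended kernel may be replaced by the original one.
  have hfield : ∀ t z, flowField hg μ₀ (α t) z
      = ∫ w, g (Φ t z) (Φ t w) ∂(μ₀ : Measure (State d A)) := by
    intro t z
    rw [flowField_apply]
    refine integral_congr_ae (ae_of_all _ fun w => ?_)
    exact ambientKernel_toAmb g (Φ t z) (Φ t w)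
  refine ⟨Φ, (((M + 2 * L) + (M + 2 * K)).toNNReal : ℝ) * M, ?_, ?_, fun t z => rfl,
    fun t z => ?_, fun t z ε hε => ?_, ?_⟩
  · intro t
    exact (Continuous.subtype_mk (α t).continuous _).prodMk continuous_snd
  · intro z
    refine Prod.ext (Subtype.ext ?_) rfl
    simp only [hΦ, h0]; rfl
  · rw [← hfield]; exact hα' t z
  · rw [← hfield]
    have h1 := norm_integralCurve_sub_sub_le (lipschitzWith_flowField hg μ₀)
      (norm_flowField_le hg μ₀) hα (t := t) hε
    exact (ContinuousMap.norm_coe_le_norm (α (t + ε) - α t - ε • flowField hg μ₀ (α t)) z).trans h1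
  · positivity

end Flow

/-! ### Laws of random characteristics are weak solutions -/

section Lagrangian

variable {d : ℕ} {A : Type*} [MetricSpace A] [CompactSpace A] [MeasurableSpace A] [BorelSpace A]
  {gradh g : State d A → State d A → Amb d} {M L K : ℝ}

theorem IsTangentKernel.continuous_integral (hg : IsTangentKernel g M L K)
    (μ : Measure (State d A)) [IsFiniteMeasure μ] : Continuous fun z => ∫ w, g z w ∂μ := by
  refine continuous_of_dominated (bound := fun _ => M) (fun z => ?_) (fun z => ?_)
      (integrable_const _) (ae_of_all _ fun w => ?_)
  · exact (integrable_of_continuous (hg.continuous.comp (f := fun w => (z, w)) (by fun_prop))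
      _).aestronglyMeasurable
  · exact ae_of_all _ fun w => hg.bound _ _
  · exact hg.continuous.comp (f := fun z => (z, w)) (by fun_prop)

theorem IsTangentKernel.norm_integral_le (hg : IsTangentKernel g M L K)
    (μ : Measure (State d A)) [IsProbabilityMeasure μ] (z : State d A) :
    ‖∫ w, g z w ∂μ‖ ≤ M :=
  (norm_integral_le_of_norm_le_const (ae_of_all _ fun w => hg.bound _ _)).trans (by simp)

theorem IsC1.exists_bound {φ : State d A → ℝ} {gradφ : State d A → Amb d} (hφ : IsC1 φ gradφ) :
    ∃ B, 0 ≤ B ∧ ∀ z, ‖gradφ z‖ ≤ B := by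
  obtain ⟨B, hB⟩ := (isCompact_range hφ.continuous_grad).isBounded.exists_norm_le
  exact ⟨max B 0, le_max_right _ _, fun z => (hB _ (mem_range_self z)).trans (le_max_left _ _)⟩

/-- The laws `μ_τ` of random characteristics: each path follows the velocity field `V[μ_τ]` in
its content variable and keeps its label. -/
structure IsLagrangian {Ω : Type*} [MeasurableSpace Ω] (P : Measure Ω) (Z : ℝ → Ω → State d A)
    (gradh : State d A → State d A → Amb d) (μ : ℝ≥0 → ProbabilityMeasure (State d A)) :
    Prop where
  law : ∀ τ : ℝ≥0, (μ τ : Measure (State d A)) = P.map (Z τ)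
  measurable : ∀ t, 0 ≤ t → Measurable (Z t)
  label : ∀ t, 0 ≤ t → ∀ ω, (Z t ω).2 = (Z 0 ω).2
  hasDerivWithinAt : ∀ t, 0 ≤ t → ∀ ω, HasDerivWithinAt (fun s => ((Z s ω).1 : Amb d))
    (velocity gradh (μ t.toNNReal : Measure (State d A)) (Z t ω)) (Ici 0) t

variable {Ω : Type*} [MeasurableSpace Ω] {P : Measure Ω} [IsProbabilityMeasure P]
  {Z : ℝ → Ω → State d A} {μ : ℝ≥0 → ProbabilityMeasure (State d A)}

namespace IsLagrangian

theorem integral_eq (hZ : IsLagrangian P Z gradh μ) {f : State d A → ℝ} (hf : Continuous f)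
    {t : ℝ} (ht : 0 ≤ t) :
    ∫ z, f z ∂(μ t.toNNReal : Measure (State d A)) = ∫ ω, f (Z t ω) ∂P := by
  rw [hZ.law, Real.coe_toNNReal _ ht,
    integral_map (hZ.measurable t ht).aemeasurable hf.measurable.aestronglyMeasurable]

theorem eq_mk (hZ : IsLagrangian P Z gradh μ) {t : ℝ} (ht : 0 ≤ t) (ω : Ω) :
    Z t ω = ((Z t ω).1, (Z 0 ω).2) := Prod.ext rfl (hZ.label t ht ω)

theorem hasDerivWithinAt_comp (hZ : IsLagrangian P Z gradh μ) {φ : State d A → ℝ}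
    {gradφ : State d A → Amb d} (hφ : IsC1 φ gradφ) {t : ℝ} (ht : 0 ≤ t) (ω : Ω) :
    HasDerivWithinAt (fun s => φ (Z s ω)) (inner ℝ (gradφ (Z t ω))
      (velocity gradh (μ t.toNNReal : Measure (State d A)) (Z t ω))) (Ici 0) t := by
  have h1 : HasSphereGradientAt (fun x' => φ (x', (Z 0 ω).2)) (gradφ (Z t ω)) (Z t ω).1 := by
    have h2 := hφ.hasGradient (Z t ω).1 (Z 0 ω).2
    rwa [← hZ.eq_mk ht] at h2
  refine (HasSphereGradientAt.comp_hasDerivWithinAt (γ := fun s => (Z s ω).1) h1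
    (hZ.hasDerivWithinAt t ht ω)).congr
    (fun s hs => ?_) ?_
  · rw [hZ.eq_mk hs]
  · rw [hZ.eq_mk ht]

theorem continuousOn_path (hZ : IsLagrangian P Z gradh μ) (ω : Ω) :
    ContinuousOn (fun t => Z t ω) (Ici 0) := by
  intro t ht
  have h1 : ContinuousWithinAt (fun t => (Z t ω).1) (Ici 0) t :=
    tendsto_subtype_rng.2 (hZ.hasDerivWithinAt t ht ω).continuousWithinAt
  exact (h1.prodMk (continuousWithinAt_const (b := (Z 0 ω).2))).congr
    (fun s hs => hZ.eq_mk hs ω) (hZ.eq_mk ht ω)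

theorem continuous (hZ : IsLagrangian P Z gradh μ) : Continuous μ := by
  rw [continuous_iff_continuousAt]
  intro τ
  refine ProbabilityMeasure.tendsto_iff_forall_integral_tendsto.2 fun f => ?_
  have e : ∀ τ : ℝ≥0, ∫ z, f z ∂(μ τ : Measure (State d A)) = ∫ ω, f (Z τ ω) ∂P := by
    intro τ
    have := hZ.integral_eq f.continuous τ.coe_nonneg
    rwa [Real.toNNReal_coe] at this
  simp only [e]
  refine tendsto_integral_filter_of_dominated_convergence (fun _ => ‖f‖)
    (Eventually.of_forall fun s => ?_) (Eventually.of_forall fun s => ae_of_all _ fun ω => ?_)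
    (integrable_const _) (ae_of_all _ fun ω => ?_)
  · exact (f.continuous.measurable.comp (hZ.measurable s s.coe_nonneg)).aestronglyMeasurable
  · exact f.norm_coe_le_norm _
  · have h1 : Continuous fun s : ℝ≥0 => Z s ω :=
      (hZ.continuousOn_path ω).comp_continuous NNReal.continuous_coe fun s => s.coe_nonneg
    exact (f.continuous.comp h1).tendsto τ

/-- The chain rule along each path gives a derivative bounded by `B * M`, uniformly in the path.
Hence the tested integral is Lipschitz in time, and differentiation under the expectation is
justified by domination. -/
theorem isWeakSolution (hZ : IsLagrangian P Z gradh μ)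
    (hM : ∀ τ z, ‖velocity gradh (μ τ : Measure (State d A)) z‖ ≤ M)
    (hc : ∀ τ, Continuous (velocity gradh (μ τ : Measure (State d A)))) :
    IsWeakSolution gradh μ := by
  intro φ gradφ hφ
  obtain ⟨B, hB0, hB⟩ := hφ.exists_bound
  have hint : ∀ t, 0 ≤ t → Integrable (fun ω => φ (Z t ω)) P := by
    intro t ht
    have h1 := integrable_of_continuous hφ.continuous (μ t.toNNReal : Measure (State d A))
    rw [hZ.law, Real.coe_toNNReal _ ht] at h1
    exact h1.comp_measurable (hZ.measurable t ht)
  have hderiv_le : ∀ t ω, ‖inner ℝ (gradφ (Z t ω))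
      (velocity gradh (μ t.toNNReal : Measure (State d A)) (Z t ω))‖ ≤ B * M := fun t ω =>
    (norm_inner_le_norm _ _).trans (mul_le_mul (hB _) (hM _ _) (norm_nonneg _) hB0)
  have hM0 : 0 ≤ M := by
    obtain ⟨z⟩ := (μ 0).nonempty
    exact (norm_nonneg _).trans (hM 0 z)
  refine ⟨fun T hT => ?_, ?_⟩
  · refine LipschitzOnWith.absolutelyContinuousOnInterval (K := ⟨B * M, mul_nonneg hB0 hM0⟩) ?_
    rw [uIcc_of_le hT]
    refine LipschitzOnWith.of_dist_le_mul fun s hs t ht => ?_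
    rw [hZ.integral_eq hφ.continuous hs.1, hZ.integral_eq hφ.continuous ht.1, dist_eq_norm,
      ← integral_sub (hint s hs.1) (hint t ht.1)]
    refine (norm_integral_le_of_norm_le_const (C := B * M * dist s t)
      (ae_of_all _ fun ω => ?_)).trans (by rw [probReal_univ, mul_one]; rfl)
    rw [dist_eq_norm]
    exact (convex_Ici (0 : ℝ)).norm_image_sub_le_of_norm_hasDerivWithin_le
      (fun r hr => hZ.hasDerivWithinAt_comp hφ hr ω) (fun r _ => hderiv_le r ω) ht.1 hs.1
  -- Time zero is discarded: the paths are only differentiable from the right there, whereas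
  -- `HasDerivAt` is two-sided.
  · have hne : ∀ᵐ τ : ℝ ∂(volume.restrict (Ici (0 : ℝ))), τ ≠ 0 :=
      Measure.ae_ne _ 0
    filter_upwards [ae_restrict_mem measurableSet_Ici, hne] with τ hτ hτ0
    have hpos : 0 < τ := lt_of_le_of_ne hτ hτ0.symm
    have hmeas : ∀ t, 0 ≤ t → AEStronglyMeasurable (fun ω => φ (Z t ω)) P := fun t ht =>
      (hint t ht).aestronglyMeasurable
    have hcont' : Continuous fun z => inner ℝ (gradφ z)
        (velocity gradh (μ τ.toNNReal : Measure (State d A)) z) :=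
      hφ.continuous_grad.inner (hc _)
    have hI := (hasDerivAt_integral_of_dominated_loc_of_deriv_le (μ := P)
      (F := fun t ω => φ (Z t ω)) (F' := fun t ω => inner ℝ (gradφ (Z t ω))
        (velocity gradh (μ t.toNNReal : Measure (State d A)) (Z t ω)))
      (bound := fun _ => B * M) (Ioi_mem_nhds hpos)
      (by filter_upwards [Ioi_mem_nhds hpos] with t ht using hmeas t (le_of_lt ht))
      (hint τ hτ)
      (hcont'.measurable.comp (hZ.measurable τ hτ)).aestronglyMeasurable
      (ae_of_all _ fun ω t _ => hderiv_le t ω) (integrable_const _)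
      (ae_of_all _ fun ω t ht => (hZ.hasDerivWithinAt_comp hφ (le_of_lt ht) ω).hasDerivAt
        (Ici_mem_nhds ht))).2
    rw [hZ.integral_eq hcont' hτ]
    refine hI.congr_of_eventuallyEq ?_
    filter_upwards [Ioi_mem_nhds hpos] with t ht
    exact hZ.integral_eq hφ.continuous (le_of_lt ht)

end IsLagrangian

end Lagrangian

/-! ### Existence of weak solutions -/

section Existence

variable {d : ℕ} {A : Type*} [MetricSpace A] [CompactSpace A] [MeasurableSpace A] [BorelSpace A]
  {gradh : State d A → State d A → Amb d} {M L K Lμ : ℝ}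

/-- The law at time `τ` of the flow started from `μ₀`. -/
def flowLaw (μ₀ : ProbabilityMeasure (State d A)) (Φ : ℝ → State d A → State d A)
    (hΦ : ∀ t, Continuous (Φ t)) (τ : ℝ≥0) : ProbabilityMeasure (State d A) :=
  μ₀.map (hΦ τ).measurable.aemeasurable

theorem velocity_flowLaw (hs : SecondArgLipschitz gradh Lμ)
    (hg : IsTangentKernel (tangentGrad gradh) M L K)
    (μ₀ : ProbabilityMeasure (State d A)) {Φ : ℝ → State d A → State d A}
    (hΦ : ∀ t, Continuous (Φ t)) {t : ℝ} (ht : 0 ≤ t) (z : State d A) :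
    velocity gradh (flowLaw μ₀ Φ hΦ t.toNNReal : Measure (State d A)) z
      = ∫ w, tangentGrad gradh z (Φ t w) ∂(μ₀ : Measure (State d A)) := by
  rw [velocity_eq_integral_tangentGrad hs, flowLaw, ProbabilityMeasure.toMeasure_map,
    Real.coe_toNNReal _ ht, integral_map (hΦ t).measurable.aemeasurable]
  exact (integrable_of_continuous (hg.continuous.comp (f := fun w => (z, w)) (by fun_prop))
    _).aestronglyMeasurable

theorem IsFlow.isLagrangian (hs : SecondArgLipschitz gradh Lμ)
    (hg : IsTangentKernel (tangentGrad gradh) M L K)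
    {μ₀ : ProbabilityMeasure (State d A)} {Φ : ℝ → State d A → State d A} {C : ℝ}
    (hΦ : IsFlow (tangentGrad gradh) μ₀ Φ C) :
    IsLagrangian (μ₀ : Measure (State d A)) Φ gradh (flowLaw μ₀ Φ hΦ.continuous) where
  law τ := rfl
  measurable t _ := (hΦ.continuous t).measurable
  label t _ z := (hΦ.label t z).trans (hΦ.label 0 z).symm
  hasDerivWithinAt t ht z := by
    rw [velocity_flowLaw hs hg μ₀ hΦ.continuous ht]
    exact (hΦ.hasDerivAt t z).hasDerivWithinAt

theorem isWeakSolution_of_isLagrangian (hs : SecondArgLipschitz gradh Lμ)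
    (hg : IsTangentKernel (tangentGrad gradh) M L K)
    {Ω : Type*} [MeasurableSpace Ω] {P : Measure Ω} [IsProbabilityMeasure P]
    {Z : ℝ → Ω → State d A} {μ : ℝ≥0 → ProbabilityMeasure (State d A)}
    (hZ : IsLagrangian P Z gradh μ) : IsWeakSolution gradh μ := by
  refine hZ.isWeakSolution (M := M) (fun τ z => ?_) fun τ => ?_
  · rw [velocity_eq_integral_tangentGrad hs]
    exact hg.norm_integral_le _ z
  · rw [funext (velocity_eq_integral_tangentGrad hs (μ τ : Measure (State d A)))]
    exact hg.continuous_integral _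

end Existence

/-! ### Mollification of test functions in the content variable -/

section Mollification

variable {d : ℕ} {A : Type*} [MetricSpace A]

/-- Continuous functions on `ℝ^d × A` that are `Λ`-Lipschitz in the first variable. -/
structure IsFstLipschitz (f : Amb d × A → ℝ) (Λ : ℝ) : Prop where
  continuous : Continuous f
  lip : ∀ x y ξ, |f (x, ξ) - f (y, ξ)| ≤ Λ * ‖x - y‖
  nonneg : 0 ≤ Λ

/-- Nonnegative `C¹` functions of integral one supported in the ball of radius `δ`. -/
structure IsMollifier (ρ : Amb d → ℝ) (δ : ℝ) : Prop where
  contDiff : ContDiff ℝ 1 ρ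
  hasCompactSupport : HasCompactSupport ρ
  nonneg : ∀ y, 0 ≤ ρ y
  integral_eq_one : ∫ y, ρ y = 1
  norm_le : ∀ y, ρ y ≠ 0 → ‖y‖ ≤ δ

theorem exists_isMollifier (d : ℕ) {δ : ℝ} (hδ : 0 < δ) : ∃ ρ : Amb d → ℝ, IsMollifier ρ δ := by
  let b : ContDiffBump (0 : Amb d) := ⟨δ / 2, δ, by positivity, by linarith⟩
  refine ⟨b.normed volume, b.contDiff_normed, b.hasCompactSupport_normed,
    fun y => b.nonneg_normed y, b.integral_normed, fun y hy => ?_⟩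
  have : y ∈ Function.support (b.normed volume) := hy
  rw [b.support_normed_eq] at this
  exact (mem_ball_zero_iff.1 this).le

/-- Mollification in the first variable. -/
def mollify (ρ : Amb d → ℝ) (f : Amb d × A → ℝ) (p : Amb d × A) : ℝ :=
  ∫ y, ρ y * f (p.1 - y, p.2)

/-- The gradient in the first variable of the mollification. -/
def mollifyGrad (ρ : Amb d → ℝ) (f : Amb d × A → ℝ) (p : Amb d × A) : Amb d :=
  ∫ y, f (p.1 - y, p.2) • gradient ρ y

variable {ρ : Amb d → ℝ} {δ : ℝ}

namespace IsMollifier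

theorem continuous (hρ : IsMollifier ρ δ) : Continuous ρ := hρ.contDiff.continuous

theorem integrable_mul (hρ : IsMollifier ρ δ) {F : Amb d → ℝ} (hF : Continuous F) :
    Integrable fun y => ρ y * F y :=
  (hρ.continuous.mul hF).integrable_of_hasCompactSupport hρ.hasCompactSupport.mul_right

/-- A mollifier is a probability density concentrated on the `δ`-ball, so pointwise bounds on that
ball survive averaging. -/
theorem abs_integral_sub_le (hρ : IsMollifier ρ δ) {F G : Amb d → ℝ} (hF : Continuous F)
    (hG : Continuous G) {c : ℝ} (h : ∀ y, ‖y‖ ≤ δ → |F y - G y| ≤ c) :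
    |(∫ y, ρ y * F y) - ∫ y, ρ y * G y| ≤ c := by
  rw [← integral_sub (hρ.integrable_mul hF) (hρ.integrable_mul hG), ← Real.norm_eq_abs]
  have hi : Integrable fun y => ρ y * c := hρ.integrable_mul continuous_const
  refine (norm_integral_le_of_norm_le hi (ae_of_all _ fun y => ?_)).trans (le_of_eq ?_)
  · rw [← mul_sub, norm_mul, Real.norm_of_nonneg (hρ.nonneg y)]
    by_cases hy : ρ y = 0
    · simp [hy]
    · exact mul_le_mul_of_nonneg_left (h y (hρ.norm_le y hy)) (hρ.nonneg y)
  · rw [integral_mul_const, hρ.integral_eq_one, one_mul]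

theorem continuous_gradient (hρ : IsMollifier ρ δ) : Continuous (gradient ρ) :=
  (InnerProductSpace.toDual ℝ (Amb d)).symm.continuous.comp (hρ.contDiff.continuous_fderiv one_ne_zero)

theorem hasCompactSupport_gradient (hρ : IsMollifier ρ δ) : HasCompactSupport (gradient ρ) :=
  (hρ.hasCompactSupport.fderiv ℝ).comp_left (map_zero (InnerProductSpace.toDual ℝ (Amb d)).symm)

theorem integrable_smul_gradient (hρ : IsMollifier ρ δ) {F : Amb d → ℝ} (hF : Continuous F) :
    Integrable fun y => F y • gradient ρ y :=
  (hF.smul hρ.continuous_gradient).integrable_of_hasCompactSupport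
    hρ.hasCompactSupport_gradient.smul_left

variable {f : Amb d × A → ℝ} {Λ : ℝ}

theorem abs_mollify_sub_le (hρ : IsMollifier ρ δ) (hf : IsFstLipschitz f Λ) (p : Amb d × A) :
    |mollify ρ f p - f p| ≤ Λ * δ := by
  have hfc := hf.continuous
  have h1 := hρ.abs_integral_sub_le (F := fun y => f (p.1 - y, p.2)) (G := fun _ => f p)
    (by fun_prop) continuous_const (c := Λ * δ) fun y hy => by
      have := hf.lip (p.1 - y) p.1 p.2
      rw [sub_sub_cancel_left, norm_neg] at this
      exact this.trans (mul_le_mul_of_nonneg_left hy hf.nonneg)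
  rwa [integral_mul_const, hρ.integral_eq_one, one_mul] at h1

theorem continuous_integral_smul {E : Type*} [NormedAddCommGroup E] [NormedSpace ℝ E]
    [CompactSpace A] {k : Amb d → E} (hk : Continuous k) (hks : HasCompactSupport k)
    (hf : Continuous f) :
    Continuous fun p : Amb d × A => ∫ y, f (p.1 - y, p.2) • k y := by
  have h1 : ∀ p : Amb d × A, ∫ y, f (p.1 - y, p.2) • k y
      = ∫ y in tsupport k, f (p.1 - y, p.2) • k y := fun p => by
    rw [setIntegral_eq_integral_of_forall_compl_eq_zero]
    intro y hy
    rw [image_eq_zero_of_notMem_tsupport hy, smul_zero]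
  simp only [h1]
  exact continuous_parametric_integral_of_continuous
    (f := fun (p : Amb d × A) y => f (p.1 - y, p.2) • k y)
    (by unfold Function.uncurry; fun_prop) hks

theorem isFstLipschitz_mollify [CompactSpace A] (hρ : IsMollifier ρ δ) (hf : IsFstLipschitz f Λ) :
    IsFstLipschitz (mollify ρ f) Λ := by
  have hfc := hf.continuous
  refine ⟨?_, fun x x' ξ => ?_, hf.nonneg⟩
  · have := continuous_integral_smul hρ.continuous hρ.hasCompactSupport hf.continuous
    refine this.congr fun p => ?_
    simp only [mollify, smul_eq_mul, mul_comm (ρ _)]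
  · refine hρ.abs_integral_sub_le (by fun_prop) (by fun_prop) fun y _ => ?_
    have := hf.lip (x - y) (x' - y) ξ
    rwa [sub_sub_sub_cancel_right] at this

theorem hasGradientAt_mollify (hρ : IsMollifier ρ δ) (hf : Continuous f) (p : Amb d × A) :
    HasGradientAt (fun x => mollify ρ f (x, p.2)) (mollifyGrad ρ f p) p.1 := by
  have h1 := hρ.hasCompactSupport.hasFDerivAt_convolution_left (ContinuousLinearMap.mul ℝ ℝ)
    hρ.contDiff (g := fun x => f (x, p.2)) (μ := volume)
    (Continuous.locallyIntegrable (by fun_prop)) p.1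
  rw [hasGradientAt_iff_hasFDerivAt]
  convert! h1 using 1
  ext v
  have hcf := hρ.contDiff.continuous_fderiv one_ne_zero
  rw [InnerProductSpace.toDual_apply_apply, mollifyGrad, real_inner_comm,
    ← integral_inner (hρ.integrable_smul_gradient (by fun_prop)), convolution_def,
    ContinuousLinearMap.integral_apply]
  · refine integral_congr_ae (ae_of_all _ fun y => ?_)
    simp only [inner_smul_right, ContinuousLinearMap.precompL_apply, ContinuousLinearMap.mul_apply']
    rw [real_inner_comm, gradient, InnerProductSpace.toDual_symm_apply, mul_comm]
  · refine Continuous.integrable_of_hasCompactSupport ?_ ?_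
    · fun_prop
    · refine (hρ.hasCompactSupport.fderiv ℝ).mono fun y hy => ?_
      intro h0
      apply hy
      simp [h0]

theorem norm_mollifyGrad_le [CompactSpace A] (hρ : IsMollifier ρ δ) (hf : IsFstLipschitz f Λ)
    (p : Amb d × A) : ‖mollifyGrad ρ f p‖ ≤ Λ := by
  have h1 := (hρ.hasGradientAt_mollify hf.continuous p).hasFDerivAt
  have h2 : LipschitzWith (Real.toNNReal Λ) fun x => mollify ρ f (x, p.2) := by
    refine LipschitzWith.of_dist_le_mul fun x y => ?_
    rw [Real.coe_toNNReal _ hf.nonneg, dist_eq_norm, dist_eq_norm]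
    exact (hρ.isFstLipschitz_mollify hf).lip x y p.2
  have h3 := h1.le_of_lipschitz h2
  rwa [LinearIsometryEquiv.norm_map, Real.coe_toNNReal _ hf.nonneg] at h3

/-- The derivative is put on `ρ`, so one Lipschitz bound on `f` suffices; the price is a constant
depending on the mollifier, which enters only the `ε²` terms of the Euler step. -/
theorem norm_mollifyGrad_sub_le (hρ : IsMollifier ρ δ) (hf : IsFstLipschitz f Λ)
    (x x' : Amb d) (ξ : A) : ‖mollifyGrad ρ f (x, ξ) - mollifyGrad ρ f (x', ξ)‖
      ≤ (∫ y, ‖gradient ρ y‖) * Λ * ‖x - x'‖ := by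
  have hfc := hf.continuous
  rw [mollifyGrad, mollifyGrad, ← integral_sub (hρ.integrable_smul_gradient (by fun_prop))
    (hρ.integrable_smul_gradient (by fun_prop))]
  have hi : Integrable fun y => ‖gradient ρ y‖ :=
    (hρ.continuous_gradient.integrable_of_hasCompactSupport hρ.hasCompactSupport_gradient).norm
  refine (norm_integral_le_of_norm_le (hi.mul_const (Λ * ‖x - x'‖))
    (ae_of_all _ fun y => ?_)).trans (le_of_eq ?_)
  · rw [← sub_smul, norm_smul, mul_comm]
    refine mul_le_mul_of_nonneg_left ?_ (norm_nonneg _)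
    have := hf.lip (x - y) (x' - y) ξ
    rwa [sub_sub_sub_cancel_right] at this
  · rw [integral_mul_const, mul_assoc]

theorem continuous_mollifyGrad [CompactSpace A] (hρ : IsMollifier ρ δ) (hf : Continuous f) :
    Continuous (mollifyGrad ρ f) :=
  continuous_integral_smul hρ.continuous_gradient hρ.hasCompactSupport_gradient hf

theorem isC1_mollify [CompactSpace A] (hρ : IsMollifier ρ δ) (hf : IsFstLipschitz f Λ) :
    IsC1 (fun z : State d A => mollify ρ f (toAmb z))
      (fun z => mollifyGrad ρ f (toAmb z)) := by
  refine ⟨(hρ.isFstLipschitz_mollify hf).continuous.comp continuous_toAmb, fun x ξ => ?_,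
    (hρ.continuous_mollifyGrad hf.continuous).comp continuous_toAmb⟩
  have h1 := (hρ.hasGradientAt_mollify hf.continuous ((x : Amb d), ξ)).hasFDerivAt.isLittleO
  exact h1.comp_tendsto (continuous_subtype_val.tendsto x)

/-- Second order Taylor estimate for the mollification. -/
theorem abs_mollify_taylor_le [CompactSpace A] (hρ : IsMollifier ρ δ) (hf : IsFstLipschitz f Λ)
    (x v : Amb d) (ξ : A) :
    |mollify ρ f (x + v, ξ) - mollify ρ f (x, ξ) - inner ℝ (mollifyGrad ρ f (x, ξ)) v|
      ≤ (∫ y, ‖gradient ρ y‖) * Λ * ‖v‖ ^ 2 := by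
  have hC : 0 ≤ ∫ y, ‖gradient ρ y‖ := integral_nonneg fun _ => norm_nonneg _
  have h := (convex_closedBall x ‖v‖).norm_image_sub_le_of_norm_hasFDerivWithin_le'
    (f := fun x => mollify ρ f (x, ξ))
    (f' := fun y => InnerProductSpace.toDual ℝ (Amb d) (mollifyGrad ρ f (y, ξ)))
    (φ := InnerProductSpace.toDual ℝ (Amb d) (mollifyGrad ρ f (x, ξ)))
    (C := (∫ y, ‖gradient ρ y‖) * Λ * ‖v‖) (x := x) (y := x + v)
    (fun y _ => (hρ.hasGradientAt_mollify hf.continuous (y, ξ)).hasFDerivAt.hasFDerivWithinAt)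
    (fun y hy => by
      rw [← map_sub, LinearIsometryEquiv.norm_map]
      refine (hρ.norm_mollifyGrad_sub_le hf y x ξ).trans ?_
      refine mul_le_mul_of_nonneg_left ?_ (mul_nonneg hC hf.nonneg)
      rwa [mem_closedBall_iff_norm] at hy)
    (Metric.mem_closedBall_self (norm_nonneg _)) (by simp)
  rw [add_sub_cancel_left, InnerProductSpace.toDual_apply_apply, Real.norm_eq_abs] at h
  refine h.trans (le_of_eq ?_)
  ring

end IsMollifier

end Mollification

/-- A discrete Gronwall inequality for upper bounds `P t u` (`u` bounds a quantity at time `t`). -/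
theorem gronwall_of_step {P : ℝ → ℝ → Prop} {a η C u₀ : ℝ} (ha : 0 ≤ a) (hη : 0 ≤ η) (hC : 0 ≤ C)
    (hu₀ : 0 ≤ u₀) (hmono : ∀ t u v, u ≤ v → P t u → P t v)
    (hstep : ∀ t u ε, 0 ≤ t → 0 ≤ u → 0 ≤ ε → P t u →
      P (t + ε) ((1 + a * ε) * u + ε * (η + C * ε)))
    (h0 : P 0 u₀) {T : ℝ} (hT : 0 ≤ T) {κ : ℝ} (hκ : 0 < κ) :
    P T (Real.exp (a * T) * (u₀ + T * η) + κ) := by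
  have hind : ∀ ε : ℝ, 0 ≤ ε → ∀ k : ℕ,
      P (k * ε) (Real.exp (a * (k * ε)) * (u₀ + (k * ε) * (η + C * ε))) := by
    intro ε hε k
    induction k with
    | zero => simpa using h0
    | succ k ih =>
      have h1 := hstep _ _ ε (by positivity) (by positivity) hε ih
      have e1 : ((k + 1 : ℕ) : ℝ) * ε = k * ε + ε := by push_cast; ring
      rw [e1]
      refine hmono _ _ _ ?_ h1
      have h2 : 1 + a * ε ≤ Real.exp (a * ε) := by linarith [Real.add_one_le_exp (a * ε)]
      have h3 : Real.exp (a * (k * ε + ε)) = Real.exp (a * (k * ε)) * Real.exp (a * ε) := by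
        rw [← Real.exp_add]; congr 1; ring
      -- The error of the new step is bounded crudely by its product with the full exponential,
      -- which closes the induction.
      have h4 : 1 ≤ Real.exp (a * (k * ε + ε)) := Real.one_le_exp (by positivity)
      set X := u₀ + (k * ε) * (η + C * ε) with hX
      have hX0 : 0 ≤ X := by positivity
      calc (1 + a * ε) * (Real.exp (a * (k * ε)) * X) + ε * (η + C * ε)
          ≤ Real.exp (a * ε) * (Real.exp (a * (k * ε)) * X)
            + Real.exp (a * (k * ε + ε)) * (ε * (η + C * ε)) := by
            refine add_le_add (mul_le_mul_of_nonneg_right h2 (by positivity)) ?_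
            exact le_mul_of_one_le_left (by positivity) h4
        _ = _ := by rw [h3, hX]; ring
  -- With `N` steps of size `T / N`, the second order errors add up to at most `exp (a * T) * T * C
  -- * T / N`, which is then below `κ`.
  obtain ⟨N, hN⟩ := exists_nat_gt (Real.exp (a * T) * T * (C * T) / κ)
  have hN0 : (0 : ℝ) < N := lt_of_le_of_lt (by positivity) hN
  have h1 := hind (T / N) (by positivity) N
  rw [mul_div_cancel₀ _ hN0.ne'] at h1
  refine hmono _ _ _ ?_ h1
  rw [div_lt_iff₀ hκ] at hN
  have h2 : Real.exp (a * T) * (T * (C * (T / N))) ≤ κ := by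
    have : Real.exp (a * T) * (T * (C * (T / N))) = Real.exp (a * T) * T * (C * T) / N := by
      field_simp
    rw [this, div_le_iff₀ hN0]
    linarith
  calc _ = Real.exp (a * T) * (u₀ + T * η) + Real.exp (a * T) * (T * (C * (T / N))) := by ring
    _ ≤ _ := by linarith

/-! ### Duality distance in the content variable, and its control of the velocity -/

section Uniqueness

variable {d : ℕ} {A : Type*} [MetricSpace A] [CompactSpace A] [MeasurableSpace A] [BorelSpace A]
  {gradh g : State d A → State d A → Amb d} {M L K Lμ : ℝ}

/-- The velocity field of a law, extended to the ambient space. -/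
def ambientField (g : State d A → State d A → Amb d) (μ : ProbabilityMeasure (State d A))
    (p : Amb d × A) : Amb d :=
  ∫ w, ambientKernel g p (toAmb w) ∂(μ : Measure (State d A))

namespace IsTangentKernel

theorem norm_ambientField_le (hg : IsTangentKernel g M L K) (μ : ProbabilityMeasure (State d A))
    (p : Amb d × A) : ‖ambientField g μ p‖ ≤ M :=
  (norm_integral_le_of_norm_le_const (ae_of_all _ fun _ => hg.norm_ambientKernel_le _ _)).trans
    (by simp)

theorem norm_ambientField_sub_le (hg : IsTangentKernel g M L K)
    (μ : ProbabilityMeasure (State d A)) (x x' : Amb d) (ξ : A) :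
    ‖ambientField g μ (x, ξ) - ambientField g μ (x', ξ)‖ ≤ (M + 2 * L) * ‖x - x'‖ := by
  rw [ambientField, ambientField, ← integral_sub
    (integrable_ambientKernel hg μ _ continuous_toAmb)
    (integrable_ambientKernel hg μ _ continuous_toAmb)]
  exact (norm_integral_le_of_norm_le_const (ae_of_all _ fun _ =>
    hg.lip_fst_ambientKernel _ _ _ _)).trans (by simp)

theorem continuous_ambientField (hg : IsTangentKernel g M L K)
    (μ : ProbabilityMeasure (State d A)) : Continuous (ambientField g μ) := by
  have := nonempty_sph μ
  refine continuous_of_dominated (bound := fun _ => M) (fun p => ?_) (fun p => ?_)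
      (integrable_const _) (ae_of_all _ fun w => ?_)
  · exact (integrable_ambientKernel hg μ p continuous_toAmb).aestronglyMeasurable
  · exact ae_of_all _ fun w => hg.norm_ambientKernel_le _ _
  · exact hg.continuous_ambientKernel.comp (f := fun p => (p, toAmb w)) (by fun_prop)

end IsTangentKernel

theorem ambientField_toAmb (hs : SecondArgLipschitz gradh Lμ)
    (μ : ProbabilityMeasure (State d A)) (z : State d A) :
    ambientField (tangentGrad gradh) μ (toAmb z)
      = velocity gradh (μ : Measure (State d A)) z := by
  simp only [ambientField, ambientKernel_toAmb, velocity_eq_integral_tangentGrad hs]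

/-- The integral of a function on the ambient space against a law on the state space. -/
def ambInt (μ : ProbabilityMeasure (State d A)) (f : Amb d × A → ℝ) : ℝ :=
  ∫ z, f (toAmb z) ∂(μ : Measure (State d A))

theorem integrable_comp_toAmb (μ : ProbabilityMeasure (State d A)) {f : Amb d × A → ℝ}
    (hf : Continuous f) : Integrable (fun z => f (toAmb z)) (μ : Measure (State d A)) :=
  integrable_of_continuous (hf.comp continuous_toAmb) _

theorem abs_ambInt_sub_le (μ : ProbabilityMeasure (State d A)) {f f' : Amb d × A → ℝ}
    (hf : Continuous f) (hf' : Continuous f') {c : ℝ} (h : ∀ p, |f p - f' p| ≤ c) :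
    |ambInt μ f - ambInt μ f'| ≤ c := by
  rw [ambInt, ambInt, ← integral_sub (integrable_comp_toAmb μ hf) (integrable_comp_toAmb μ hf'), ← Real.norm_eq_abs]
  exact (norm_integral_le_of_norm_le_const (ae_of_all _ fun z => h (toAmb z))).trans (by simp)

/-- The integrals of functions that are Lipschitz in the content variable differ by at most `c`
times the Lipschitz constant. -/
def FstClose (μ ν : ProbabilityMeasure (State d A)) (c : ℝ) : Prop :=
  ∀ f Λ, IsFstLipschitz f Λ → |ambInt μ f - ambInt ν f| ≤ c * Λ

/-- By duality: for a vector `e`, the function `q ↦ ⟨e, kernel p q⟩` is an admissible test function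
with constant `(M + 2 * K) * ‖e‖`; then `e` is taken to be the difference of the fields itself. -/
theorem IsTangentKernel.norm_ambientField_sub_le_of_fstClose (hg : IsTangentKernel g M L K)
    {μ ν : ProbabilityMeasure (State d A)} {c : ℝ} (h : FstClose μ ν c) (p : Amb d × A) :
    ‖ambientField g μ p - ambientField g ν p‖ ≤ (M + 2 * K) * c := by
  have := nonempty_sph μ
  have hM := hg.M_nonneg
  have hK := hg.K_nonneg
  have key : ∀ e : Amb d, inner ℝ (ambientField g μ p - ambientField g ν p) e
      ≤ (M + 2 * K) * c * ‖e‖ := by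
    intro e
    have hlip : IsFstLipschitz (fun q : Amb d × A => inner ℝ e (ambientKernel g p q))
        ((M + 2 * K) * ‖e‖) := by
      refine ⟨?_, fun x y ξ => ?_, by positivity⟩
      · exact continuous_const.inner
          (hg.continuous_ambientKernel.comp (f := fun q => (p, q)) (by fun_prop))
      · rw [← inner_sub_right]
        refine (abs_real_inner_le_norm _ _).trans ?_
        calc _ ≤ ‖e‖ * ((M + 2 * K) * ‖x - y‖) :=
              mul_le_mul_of_nonneg_left (hg.lip_snd_ambientKernel _ _ _ _) (norm_nonneg _)
          _ = _ := by ring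
    have h1 := h _ _ hlip
    simp only [ambInt] at h1
    rw [integral_inner (integrable_ambientKernel hg μ p continuous_toAmb),
      integral_inner (integrable_ambientKernel hg ν p continuous_toAmb), ← inner_sub_right] at h1
    rw [real_inner_comm]
    refine (le_abs_self _).trans (h1.trans (le_of_eq ?_))
    ring
  have h2 := key (ambientField g μ p - ambientField g ν p)
  rw [real_inner_self_eq_norm_sq] at h2
  rcases (norm_nonneg (ambientField g μ p - ambientField g ν p)).eq_or_lt with h0 | hpos
  · rw [← h0]
    -- Testing with the zero function and Lipschitz constant 1 yields `0 ≤ c`.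
    have h3 := (abs_nonneg _).trans (h (fun q => inner ℝ (0 : Amb d) q.1) 1
      ⟨by fun_prop, fun x y ξ => by simp, zero_le_one⟩)
    rw [mul_one] at h3
    positivity
  · rw [sq] at h2
    exact le_of_mul_le_mul_right h2 hpos

/-- Integrated form of the weak equation: a bound for the remainder of the Euler step. -/
theorem IsWeakSolution.abs_sub_sub_le {μ : ℝ≥0 → ProbabilityMeasure (State d A)}
    (hμ : IsWeakSolution gradh μ) {φ : State d A → ℝ} {gradφ : State d A → Amb d}
    (hφ : IsC1 φ gradφ) {s t c η : ℝ} (hs : 0 ≤ s) (hst : s ≤ t)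
    (h : ∀ r, s ≤ r → r ≤ t → |∫ z, inner ℝ (gradφ z)
      (velocity gradh (μ r.toNNReal : Measure (State d A)) z)
        ∂(μ r.toNNReal : Measure (State d A)) - c| ≤ η) :
    |∫ z, φ z ∂(μ t.toNNReal : Measure (State d A))
      - ∫ z, φ z ∂(μ s.toNNReal : Measure (State d A)) - (t - s) * c| ≤ η * (t - s) := by
  obtain ⟨hac, hder⟩ := hμ φ gradφ hφ
  have hac' := (hac t (hs.trans hst)).mono (c := s) (d := t) (by
    rw [uIcc_of_le hst, uIcc_of_le (hs.trans hst)]; exact Icc_subset_Icc_left hs)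
  have h1 := hac'.integral_deriv_eq_sub
  have h2 : ∫ r in s..t, (deriv (fun τ : ℝ => ∫ z, φ z ∂(μ τ.toNNReal : Measure (State d A))) r - c)
      = ∫ z, φ z ∂(μ t.toNNReal : Measure (State d A))
      - ∫ z, φ z ∂(μ s.toNNReal : Measure (State d A)) - (t - s) * c := by
    rw [intervalIntegral.integral_sub hac'.intervalIntegrable_deriv
      intervalIntegrable_const, h1, intervalIntegral.integral_const, smul_eq_mul]
  rw [← h2, ← Real.norm_eq_abs]
  refine (intervalIntegral.norm_integral_le_of_norm_le_const_ae (C := η) ?_).trans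
    (le_of_eq ?_)
  · filter_upwards [(ae_restrict_iff' measurableSet_Ici).1 hder] with r hr hrI
    rw [uIoc_of_le hst] at hrI
    rw [(hr (hs.trans hrI.1.le)).deriv]
    exact h r hrI.1.le hrI.2
  · rw [abs_of_nonneg (by linarith)]

/-- Mass moves with speed at most `M` and mollified test functions have gradient at most `Λ`; the
weak equation then bounds the change by `Λ * M * (t - s)`. -/
theorem IsWeakSolution.fstClose (hs : SecondArgLipschitz gradh Lμ)
    (hg : IsTangentKernel (tangentGrad gradh) M L K)
    {μ : ℝ≥0 → ProbabilityMeasure (State d A)} (hμ : IsWeakSolution gradh μ) {s t : ℝ}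
    (hs0 : 0 ≤ s) (hst : s ≤ t) : FstClose (μ t.toNNReal) (μ s.toNNReal) (M * (t - s)) := by
  intro f Λ hf
  have hM := hg.M_nonneg
  have hΛ := hf.nonneg
  refine le_of_forall_pos_le_add fun κ hκ => ?_
  -- With this mollification radius the two replacement errors `Λ * δ` add up to at most `κ`; the `+
  -- 1` covers `Λ = 0`.
  have hpos : 0 < κ / (2 * Λ + 1) := by positivity
  obtain ⟨ρ, hρ⟩ := exists_isMollifier d hpos
  have hb := hμ.abs_sub_sub_le (hρ.isC1_mollify hf) hs0 hst (c := 0) (η := Λ * M) (fun r _ _ => by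
    rw [sub_zero, ← Real.norm_eq_abs]
    refine (norm_integral_le_of_norm_le_const (C := Λ * M) (ae_of_all _ fun z => ?_)).trans
      (by simp)
    refine (norm_inner_le_norm _ _).trans
      (mul_le_mul (hρ.norm_mollifyGrad_le hf _) ?_ (norm_nonneg _) hf.nonneg)
    rw [← ambientField_toAmb hs]
    exact hg.norm_ambientField_le _ _)
  rw [mul_zero, sub_zero] at hb
  have hc := (hρ.isFstLipschitz_mollify hf).continuous
  have h1 := abs_ambInt_sub_le (μ t.toNNReal) hc hf.continuous (hρ.abs_mollify_sub_le hf)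
  have h2 := abs_ambInt_sub_le (μ s.toNNReal) hc hf.continuous (hρ.abs_mollify_sub_le hf)
  have h3 : 2 * (Λ * (κ / (2 * Λ + 1))) ≤ κ := by
    rw [← mul_assoc, ← mul_div_assoc, div_le_iff₀ (by positivity)]
    nlinarith
  change |ambInt (μ t.toNNReal) (mollify ρ f) - ambInt (μ s.toNNReal) (mollify ρ f)| ≤ _ at hb
  rw [abs_le] at h1 h2 hb ⊢
  constructor <;> nlinarith

end Uniqueness

/-! ### Euler steps on test functions and uniqueness of weak solutions -/

section Uniqueness

variable {d : ℕ} {A : Type*} [MetricSpace A] [CompactSpace A] [MeasurableSpace A] [BorelSpace A]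
  {gradh g : State d A → State d A → Amb d} {M L K Lμ : ℝ}

/-- Composition with the explicit Euler step `x ↦ x + ε b(x, ξ)`. -/
def eulerComp (f : Amb d × A → ℝ) (b : Amb d × A → Amb d) (ε : ℝ) (p : Amb d × A) : ℝ :=
  f (p.1 + ε • b p, p.2)

/-- The Euler map is `(1 + B * ε)`-Lipschitz in `x` and fixes the label, so continuity of `b` in the
label is enough to remain in the class of test functions. -/
theorem IsFstLipschitz.eulerComp {f : Amb d × A → ℝ} {Λ : ℝ} (hf : IsFstLipschitz f Λ)
    {b : Amb d × A → Amb d} (hb : Continuous b) {B : ℝ} (hB0 : 0 ≤ B)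
    (hB : ∀ x x' ξ, ‖b (x, ξ) - b (x', ξ)‖ ≤ B * ‖x - x'‖) {ε : ℝ} (hε : 0 ≤ ε) :
    IsFstLipschitz (eulerComp f b ε) ((1 + B * ε) * Λ) := by
  have hΛ := hf.nonneg
  have hc := hf.continuous
  refine ⟨by unfold USAAV.eulerComp; fun_prop, fun x y ξ => ?_, by positivity⟩
  refine (hf.lip _ _ _).trans ?_
  have e : x + ε • b (x, ξ) - (y + ε • b (y, ξ)) = (x - y) + ε • (b (x, ξ) - b (y, ξ)) := by
    rw [smul_sub]; abel
  have h1 : ‖x + ε • b (x, ξ) - (y + ε • b (y, ξ))‖ ≤ ‖x - y‖ + ε * (B * ‖x - y‖) := by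
    rw [e]
    refine (norm_add_le _ _).trans ?_
    rw [norm_smul, Real.norm_of_nonneg hε]
    exact add_le_add le_rfl (mul_le_mul_of_nonneg_left (hB _ _ _) hε)
  calc _ ≤ Λ * (‖x - y‖ + ε * (B * ‖x - y‖)) := mul_le_mul_of_nonneg_left h1 hΛ
    _ = _ := by ring

variable {ρ : Amb d → ℝ} {δ : ℝ}

/-- Mollification almost commutes with the composition with an Euler step. -/
theorem IsMollifier.abs_mollify_eulerComp_sub_le (hρ : IsMollifier ρ δ) {f : Amb d × A → ℝ}
    {Λ : ℝ} (hf : IsFstLipschitz f Λ) {b : Amb d × A → Amb d} (hb : Continuous b) {B : ℝ}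
    (hB0 : 0 ≤ B) (hB : ∀ x x' ξ, ‖b (x, ξ) - b (x', ξ)‖ ≤ B * ‖x - x'‖) {ε : ℝ} (hε : 0 ≤ ε)
    (p : Amb d × A) :
    |mollify ρ f (p.1 + ε • b p, p.2) - mollify ρ (eulerComp f b ε) p| ≤ Λ * (ε * (B * δ)) := by
  have hc := hf.continuous
  refine hρ.abs_integral_sub_le (F := fun y => f (p.1 + ε • b p - y, p.2))
    (G := fun y => eulerComp f b ε (p.1 - y, p.2)) (by fun_prop)
    (by unfold eulerComp; fun_prop) fun y hy => ?_
  refine (hf.lip _ _ _).trans (mul_le_mul_of_nonneg_left ?_ hf.nonneg)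
  have e : p.1 + ε • b p - y - (p.1 - y + ε • b (p.1 - y, p.2))
      = ε • (b (p.1, p.2) - b (p.1 - y, p.2)) := by rw [smul_sub]; abel
  rw [e, norm_smul, Real.norm_of_nonneg hε]
  refine mul_le_mul_of_nonneg_left ((hB _ _ _).trans (mul_le_mul_of_nonneg_left ?_ hB0)) hε
  rwa [sub_sub_cancel]

theorem IsMollifier.abs_mollify_sub_mollify_le (hρ : IsMollifier ρ δ)
    {f f' : Amb d × A → ℝ} (hf : Continuous f) (hf' : Continuous f') {c : ℝ}
    (h : ∀ p, |f p - f' p| ≤ c) (p : Amb d × A) : |mollify ρ f p - mollify ρ f' p| ≤ c :=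
  hρ.abs_integral_sub_le (by fun_prop) (by fun_prop) fun _ _ => h _

/-- `⟨∇f^δ, b⟩` is Lipschitz in the content variable. -/
theorem IsMollifier.isFstLipschitz_inner (hρ : IsMollifier ρ δ) {f : Amb d × A → ℝ} {Λ : ℝ}
    (hf : IsFstLipschitz f Λ) {b : Amb d × A → Amb d} (hb : Continuous b) {B : ℝ} (hB0 : 0 ≤ B)
    (hB : ∀ x x' ξ, ‖b (x, ξ) - b (x', ξ)‖ ≤ B * ‖x - x'‖) (hM : ∀ p, ‖b p‖ ≤ M) (hM0 : 0 ≤ M) :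
    IsFstLipschitz (fun p => inner ℝ (mollifyGrad ρ f p) (b p))
      (((∫ y, ‖gradient ρ y‖) * M + B) * Λ) := by
  have hN : 0 ≤ ∫ y, ‖gradient ρ y‖ := integral_nonneg fun _ => norm_nonneg _
  have hΛ := hf.nonneg
  refine ⟨(hρ.continuous_mollifyGrad hf.continuous).inner hb, fun x y ξ => ?_, by positivity⟩
  have e : inner ℝ (mollifyGrad ρ f (x, ξ)) (b (x, ξ))
      - inner ℝ (mollifyGrad ρ f (y, ξ)) (b (y, ξ))
      = inner ℝ (mollifyGrad ρ f (x, ξ) - mollifyGrad ρ f (y, ξ)) (b (x, ξ))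
        + inner ℝ (mollifyGrad ρ f (y, ξ)) (b (x, ξ) - b (y, ξ)) := by
    rw [inner_sub_left, inner_sub_right]; ring
  rw [e]
  refine (abs_add_le _ _).trans ?_
  have h1 := (abs_real_inner_le_norm (mollifyGrad ρ f (x, ξ) - mollifyGrad ρ f (y, ξ))
    (b (x, ξ))).trans (mul_le_mul (hρ.norm_mollifyGrad_sub_le hf x y ξ) (hM _) (norm_nonneg _)
      (by positivity))
  have h2 := (abs_real_inner_le_norm (mollifyGrad ρ f (y, ξ)) (b (x, ξ) - b (y, ξ))).trans
    (mul_le_mul (hρ.norm_mollifyGrad_le hf _) (hB _ _ _) (norm_nonneg _) hΛ)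
  linarith

/-- Euler step for a weak solution tested against mollified functions. -/
theorem IsWeakSolution.abs_ambInt_mollify_sub_le (hs : SecondArgLipschitz gradh Lμ)
    (hg : IsTangentKernel (tangentGrad gradh) M L K)
    {μ : ℝ≥0 → ProbabilityMeasure (State d A)} (hμ : IsWeakSolution gradh μ)
    (hρ : IsMollifier ρ δ) {f : Amb d × A → ℝ} {Λ : ℝ} (hf : IsFstLipschitz f Λ) {t ε : ℝ}
    (ht : 0 ≤ t) (hε : 0 ≤ ε) :
    |ambInt (μ (t + ε).toNNReal) (mollify ρ f) - ambInt (μ t.toNNReal)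
      (mollify ρ (eulerComp f (ambientField (tangentGrad gradh) (μ t.toNNReal)) ε))|
      ≤ (((M + 2 * K) * M + (2 * (∫ y, ‖gradient ρ y‖) * M + (M + 2 * L)) * M) * ε ^ 2
        + ε * ((M + 2 * L) * δ)) * Λ := by
  have hM := hg.M_nonneg
  have hL := hg.L_nonneg
  have hK := hg.K_nonneg
  have hΛ := hf.nonneg
  set N := ∫ y, ‖gradient ρ y‖ with hNdef
  have hN : 0 ≤ N := integral_nonneg fun _ => norm_nonneg _
  set b := ambientField (tangentGrad gradh) (μ t.toNNReal) with hbdef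
  have hbc : Continuous b := hg.continuous_ambientField _
  have hbL : ∀ x x' ξ, ‖b (x, ξ) - b (x', ξ)‖ ≤ (M + 2 * L) * ‖x - x'‖ :=
    hg.norm_ambientField_sub_le _
  have hbM : ∀ p, ‖b p‖ ≤ M := hg.norm_ambientField_le _
  have hB0 : 0 ≤ M + 2 * L := by positivity
  have hin := hρ.isFstLipschitz_inner hf hbc hB0 hbL hbM hM
  have hGc := hρ.continuous_mollifyGrad hf.continuous
  have hmc := (hρ.isFstLipschitz_mollify hf).continuous
  have hec := (hρ.isFstLipschitz_mollify (hf.eulerComp hbc hB0 hbL hε)).continuous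
  -- the weak equation on `[t, t + ε]`
  have h1 := hμ.abs_sub_sub_le (hρ.isC1_mollify hf) ht (t := t + ε) (by linarith)
    (c := ambInt (μ t.toNNReal) (fun p => inner ℝ (mollifyGrad ρ f p) (b p)))
    (η := (((M + 2 * K) * M + (N * M + (M + 2 * L)) * M) * ε) * Λ) (fun r hr1 hr2 => by
      have hclose := hμ.fstClose hs hg ht hr1
      have hle : M * (r - t) ≤ M * ε := mul_le_mul_of_nonneg_left (by linarith) hM
      have e1 : ∫ z, inner ℝ (mollifyGrad ρ f (toAmb z))
          (velocity gradh (μ r.toNNReal : Measure (State d A)) z)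
            ∂(μ r.toNNReal : Measure (State d A))
          = ambInt (μ r.toNNReal) (fun p => inner ℝ (mollifyGrad ρ f p)
              (ambientField (tangentGrad gradh) (μ r.toNNReal) p)) := by
        simp only [ambInt, ambientField_toAmb hs]
      rw [e1]
      -- Two errors, both proportional to `r - t`: here the field at time `r` is replaced by the
      -- field at time `t`, and in `h3` the law `μ_r` is replaced by `μ_t`, tested against the
      -- Lipschitz function of `hin`.
      have h2 := abs_ambInt_sub_le (μ r.toNNReal)
        (f := fun p => inner ℝ (mollifyGrad ρ f p)
              (ambientField (tangentGrad gradh) (μ r.toNNReal) p))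
        (f' := fun p => inner ℝ (mollifyGrad ρ f p) (b p))
        (hGc.inner (hg.continuous_ambientField _)) (hGc.inner hbc)
        (c := Λ * ((M + 2 * K) * (M * (r - t)))) (fun p => by
          rw [← inner_sub_right]
          exact (abs_real_inner_le_norm _ _).trans
            (mul_le_mul (hρ.norm_mollifyGrad_le hf _)
              (hg.norm_ambientField_sub_le_of_fstClose hclose p) (norm_nonneg _) hΛ))
      have h3 := hclose _ _ hin
      refine (abs_sub_le _ _ _).trans ((add_le_add h2 h3).trans ?_)
      have h4 : Λ * ((M + 2 * K) * (M * (r - t))) + M * (r - t) * ((N * M + (M + 2 * L)) * Λ)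
          = (Λ * ((M + 2 * K) + (N * M + (M + 2 * L)))) * (M * (r - t)) := by ring
      rw [h4]
      refine (mul_le_mul_of_nonneg_left hle (by positivity)).trans (le_of_eq ?_)
      ring)
  rw [add_sub_cancel_left] at h1
  -- Taylor expansion and commutation of the mollification with the Euler step
  have h2 := abs_ambInt_sub_le (μ t.toNNReal)
    (f := fun p => mollify ρ f p + ε * inner ℝ (mollifyGrad ρ f p) (b p))
    (f' := mollify ρ (eulerComp f b ε)) (hmc.add (continuous_const.mul hin.continuous)) hec
    (c := N * Λ * (ε ^ 2 * M ^ 2) + Λ * (ε * ((M + 2 * L) * δ))) (fun p => by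
      have t1 := hρ.abs_mollify_taylor_le hf p.1 (ε • b p) p.2
      have t2 := hρ.abs_mollify_eulerComp_sub_le hf hbc hB0 hbL hε p
      have t3 : ‖ε • b p‖ ^ 2 ≤ ε ^ 2 * M ^ 2 := by
        rw [norm_smul, Real.norm_of_nonneg hε, mul_pow]
        exact mul_le_mul_of_nonneg_left (pow_le_pow_left₀ (norm_nonneg _) (hbM p) 2) (by positivity)
      have t4 := mul_le_mul_of_nonneg_left t3 (mul_nonneg hN hΛ)
      rw [inner_smul_right] at t1
      rw [abs_le] at t1 t2 ⊢
      constructor <;> linarith [t1.1, t1.2, t2.1, t2.2])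
  have h3 : ambInt (μ t.toNNReal) (fun p => mollify ρ f p + ε * inner ℝ (mollifyGrad ρ f p) (b p))
      = ambInt (μ t.toNNReal) (mollify ρ f)
        + ε * ambInt (μ t.toNNReal) (fun p => inner ℝ (mollifyGrad ρ f p) (b p)) := by
    rw [ambInt, integral_add (integrable_comp_toAmb _ hmc)
      ((integrable_comp_toAmb _ hin.continuous).const_mul ε), integral_const_mul]
    rfl
  rw [h3] at h2
  change |ambInt (μ (t + ε).toNNReal) (mollify ρ f) - ambInt (μ t.toNNReal) (mollify ρ f) - _| ≤ _
    at h1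
  rw [abs_le] at h1 h2 ⊢
  constructor <;> nlinarith [h1.1, h1.2, h2.1, h2.2]

/-- The integrals of mollified functions differ by at most `u` times the Lipschitz constant. -/
def MollifiedClose (ρ : Amb d → ℝ) (μ ν : ProbabilityMeasure (State d A)) (u : ℝ) : Prop :=
  ∀ f Λ, IsFstLipschitz f Λ → |ambInt μ (mollify ρ f) - ambInt ν (mollify ρ f)| ≤ u * Λ

theorem IsMollifier.fstClose (hρ : IsMollifier ρ δ) {μ ν : ProbabilityMeasure (State d A)} {u : ℝ}
    (h : MollifiedClose ρ μ ν u) : FstClose μ ν (u + 2 * δ) := by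
  intro f Λ hf
  have hc := (hρ.isFstLipschitz_mollify hf).continuous
  have h1 := abs_ambInt_sub_le μ hc hf.continuous (hρ.abs_mollify_sub_le hf)
  have h2 := abs_ambInt_sub_le ν hc hf.continuous (hρ.abs_mollify_sub_le hf)
  have h3 := h f Λ hf
  rw [abs_le] at h1 h2 h3 ⊢
  constructor <;> nlinarith [h1.1, h1.2, h2.1, h2.2, h3.1, h3.2]

/-- The comparison is restricted to mollified functions because the Euler step turns the
mollification of `f` into the mollification of `eulerComp f b ε`, which stays in the class. The
growth rate adds `M + 2 * L` from the Lipschitz constant of the Euler map and `M + 2 * K` from the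
difference of the two velocities. The `δ` term collects the two commutation errors and the passage
from `MollifiedClose` to `FstClose`. -/
theorem mollifiedClose_step (hs : SecondArgLipschitz gradh Lμ)
    (hg : IsTangentKernel (tangentGrad gradh) M L K) (hρ : IsMollifier ρ δ)
    {μ ν : ℝ≥0 → ProbabilityMeasure (State d A)} (hμ : IsWeakSolution gradh μ)
    (hν : IsWeakSolution gradh ν) {t u ε : ℝ} (ht : 0 ≤ t) (hε : 0 ≤ ε)
    (h : MollifiedClose ρ (μ t.toNNReal) (ν t.toNNReal) u) :
    MollifiedClose ρ (μ (t + ε).toNNReal) (ν (t + ε).toNNReal)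
      ((1 + ((M + 2 * L) + (M + 2 * K)) * ε) * u
        + ε * (2 * ((M + 2 * L) + (M + 2 * K)) * δ
        + 2 * ((M + 2 * K) * M + (2 * (∫ y, ‖gradient ρ y‖) * M + (M + 2 * L)) * M) * ε)) := by
  intro f Λ hf
  have hM := hg.M_nonneg
  have hL := hg.L_nonneg
  have hK := hg.K_nonneg
  have hΛ := hf.nonneg
  have hB0 : 0 ≤ M + 2 * L := by positivity
  set bμ := ambientField (tangentGrad gradh) (μ t.toNNReal) with hbμ
  set bν := ambientField (tangentGrad gradh) (ν t.toNNReal) with hbν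
  have heμ := hf.eulerComp (hg.continuous_ambientField (μ t.toNNReal)) hB0
    (hg.norm_ambientField_sub_le _) hε
  have heν := hf.eulerComp (hg.continuous_ambientField (ν t.toNNReal)) hB0
    (hg.norm_ambientField_sub_le _) hε
  have h1 := hμ.abs_ambInt_mollify_sub_le hs hg hρ hf ht hε
  have h2 := hν.abs_ambInt_mollify_sub_le hs hg hρ hf ht hε
  have h3 := h _ _ heμ
  have h4 := abs_ambInt_sub_le (ν t.toNNReal) (hρ.isFstLipschitz_mollify heμ).continuous
    (hρ.isFstLipschitz_mollify heν).continuous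
    (hρ.abs_mollify_sub_mollify_le heμ.continuous heν.continuous
      (c := Λ * (ε * ((M + 2 * K) * (u + 2 * δ)))) fun p => by
        refine (hf.lip _ _ _).trans (mul_le_mul_of_nonneg_left ?_ hΛ)
        rw [add_sub_add_left_eq_sub, ← smul_sub, norm_smul, Real.norm_of_nonneg hε]
        exact mul_le_mul_of_nonneg_left
          (hg.norm_ambientField_sub_le_of_fstClose (hρ.fstClose h) p) hε)
  set N := ∫ y, ‖gradient ρ y‖
  rw [abs_le] at h1 h2 h3 h4 ⊢
  constructor <;> nlinarith [h1.1, h1.2, h2.1, h2.2, h3.1, h3.2, h4.1, h4.2]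

/-- Lipschitz functions on `X` determine a law, and each of them extends radially to an admissible
test function. -/
theorem eq_of_fstClose {μ ν : ProbabilityMeasure (State d A)}
    (h : ∀ c, 0 < c → FstClose μ ν c) : μ = ν := by
  have := nonempty_sph μ
  -- The Lipschitz characterisation of weak convergence is applied to a constant sequence; limits
  -- being unique, the two laws coincide.
  have hlim : Tendsto (fun _ : ℕ => μ) atTop (𝓝 ν) := by
    refine tendsto_iff_forall_lipschitz_integral_tendsto.2 fun f _ hfL => ?_
    obtain ⟨l, hl⟩ := hfL
    obtain ⟨B, hB⟩ := (isCompact_range hl.continuous).isBounded.exists_norm_le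
    have hB' : ∀ z, ‖f z‖ ≤ B := fun z => hB _ (mem_range_self z)
    obtain ⟨z₀⟩ := μ.nonempty
    have hB0 : 0 ≤ B := (norm_nonneg _).trans (hB' z₀)
    set F : Amb d × A → ℝ := fun p => radialExt (fun y : Sph d => f (y, p.2)) p.1 with hF
    have hlip : ∀ x y ξ, |F (x, ξ) - F (y, ξ)| ≤ (B + 2 * l) * ‖x - y‖ := fun x y ξ =>
      norm_radialExt_sub_le (fun y => hB' (y, ξ)) l.2 (fun y y' => by
        have := hl.dist_le_mul (y, ξ) (y', ξ)
        rw [dist_prod_same_right, dist_eq_norm] at this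
        exact this) x y
    have hcont : Continuous F := by
      refine continuous_prod_of_continuous_lipschitzWith _ (Real.toNNReal (B + 2 * l))
        (fun a => ?_) fun ξ => ?_
      · obtain ⟨x, s, hx⟩ := exists_radialExt_eq ℝ a
        simp only [hF, hx]
        exact (hl.continuous.comp (f := fun ξ => (x, ξ)) (by fun_prop)).const_smul s
      · refine LipschitzWith.of_dist_le_mul fun x y => ?_
        rw [Real.coe_toNNReal _ (by positivity), dist_eq_norm, dist_eq_norm]
        exact hlip x y ξ
    have hFL : IsFstLipschitz F (B + 2 * l) := ⟨hcont, hlip, by positivity⟩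
    have he : ∀ κ : ProbabilityMeasure (State d A),
        ambInt κ F = ∫ z, f z ∂(κ : Measure (State d A)) := by
      intro κ
      simp only [ambInt, hF, toAmb, radialExt_coe]
    have heq : ∫ z, f z ∂(μ : Measure (State d A)) = ∫ z, f z ∂(ν : Measure (State d A)) := by
      rw [← he, ← he, ← sub_eq_zero, ← abs_nonpos_iff]
      refine le_of_forall_pos_le_add fun κ hκ => ?_
      have hpos : 0 < κ / (B + 2 * l + 1) := by positivity
      refine (h _ hpos _ _ hFL).trans ?_
      rw [zero_add, div_mul_eq_mul_div, div_le_iff₀ (by positivity)]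
      nlinarith
    rw [heq]
    exact tendsto_const_nhds
  exact tendsto_nhds_unique tendsto_const_nhds hlim

/-- Weak solutions are determined by their initial datum. -/
theorem IsWeakSolution.eq_of_zero_eq (hs : SecondArgLipschitz gradh Lμ)
    (hg : IsTangentKernel (tangentGrad gradh) M L K)
    {μ ν : ℝ≥0 → ProbabilityMeasure (State d A)} (hμ : IsWeakSolution gradh μ)
    (hν : IsWeakSolution gradh ν) (h0 : μ 0 = ν 0) : μ = ν := by
  have hM := hg.M_nonneg
  have hL := hg.L_nonneg
  have hK := hg.K_nonneg
  funext τ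
  refine eq_of_fstClose fun c hc => ?_
  set a := (M + 2 * L) + (M + 2 * K) with ha
  -- With `δ = c / Q` the final bound is exactly `c`: the exponential term is the accumulated `2aδ`
  -- error, the `1` is the Gronwall slack `κ = δ`, and the `2` pays for removing the mollification.
  set Q : ℝ := Real.exp (a * τ) * (τ * (2 * a)) + 1 + 2 with hQ
  have hQpos : 0 < Q := by positivity
  have hδ : 0 < c / Q := by positivity
  obtain ⟨ρ, hρ⟩ := exists_isMollifier d hδ
  have hN : 0 ≤ ∫ y, ‖gradient ρ y‖ := integral_nonneg fun _ => norm_nonneg _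
  have key := gronwall_of_step
    (P := fun t u => MollifiedClose ρ (μ t.toNNReal) (ν t.toNNReal) u) (a := a)
    (η := 2 * a * (c / Q))
    (C := 2 * ((M + 2 * K) * M + (2 * (∫ y, ‖gradient ρ y‖) * M + (M + 2 * L)) * M)) (u₀ := 0)
    (by positivity) (by positivity) (by positivity) le_rfl
    (fun t u v huv h f Λ hf => (h f Λ hf).trans (mul_le_mul_of_nonneg_right huv hf.nonneg))
    (fun t u ε ht _ hε h => mollifiedClose_step hs hg hρ hμ hν ht hε h)
    (by
      intro f Λ hf
      simp [h0]) τ.coe_nonneg hδ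
  have h1 := hρ.fstClose key
  rw [Real.toNNReal_coe] at h1
  have h2 : Real.exp (a * τ) * (0 + τ * (2 * a * (c / Q))) + c / Q + 2 * (c / Q) = c := by
    have : Real.exp (a * τ) * (0 + τ * (2 * a * (c / Q))) + c / Q + 2 * (c / Q) = Q * (c / Q) := by
      rw [hQ]; ring
    rw [this, mul_div_cancel₀ _ hQpos.ne']
  rwa [h2] at h1

end Uniqueness

/-! ### Wasserstein stability by transporting couplings -/

section Stability

variable {d : ℕ} {A : Type*} [MetricSpace A] [CompactSpace A] [MeasurableSpace A] [BorelSpace A]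
  {h : State d A → State d A → ℝ} {gradh : State d A → State d A → Amb d} {M L K Lx Mh Lμ : ℝ}

theorem dX_nonneg (z w : State d A) : 0 ≤ dX z w := add_nonneg (norm_nonneg _) dist_nonneg

theorem continuous_dX : Continuous fun p : State d A × State d A => dX p.1 p.2 := by
  unfold dX; fun_prop

theorem FirstArgLipschitz.norm_tangentGrad_sub_le (hreg : IsRegularKernel h gradh Lx Mh)
    (hf : FirstArgLipschitz gradh Lx) (z z' w : State d A) :
    ‖tangentGrad gradh z w - tangentGrad gradh z' w‖ ≤ (Lx + 2 * Mh) * dX z z' := by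
  refine (norm_tangentProj_sub_tangentProj_le _ _ _ _).trans ?_
  have hM := hreg.Mh_nonneg z
  have h1 := hf z z' w
  have h2 : ‖(z.1 : Amb d) - z'.1‖ ≤ dX z z' := le_add_of_nonneg_right dist_nonneg
  have h3 := mul_le_mul (hreg.bounded_grad z' w) h2 (norm_nonneg _) hM
  linarith

theorem flowLaw_zero (μ₀ : ProbabilityMeasure (State d A)) {Φ : ℝ → State d A → State d A}
    (hΦ : ∀ t, Continuous (Φ t)) (h0 : ∀ z, Φ 0 z = z) : flowLaw μ₀ Φ hΦ 0 = μ₀ := by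
  apply Subtype.ext
  have : Φ ((0 : ℝ≥0) : ℝ) = id := funext h0
  rw [flowLaw, ProbabilityMeasure.map]
  simp only [this, Measure.map_id]
  rfl

/-- Every weak solution is the law of the flow started from its initial datum. -/
theorem IsWeakSolution.eq_flowLaw (hs : SecondArgLipschitz gradh Lμ)
    (hg : IsTangentKernel (tangentGrad gradh) M L K)
    {μ : ℝ≥0 → ProbabilityMeasure (State d A)} (hμ : IsWeakSolution gradh μ)
    {Φ : ℝ → State d A → State d A} {C : ℝ} (hΦ : IsFlow (tangentGrad gradh) (μ 0) Φ C) :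
    μ = flowLaw (μ 0) Φ hΦ.continuous :=
  hμ.eq_of_zero_eq hs hg (isWeakSolution_of_isLagrangian hs hg (hΦ.isLagrangian hs hg))
    (flowLaw_zero _ hΦ.continuous hΦ.zero).symm

theorem isProbabilityMeasure_of_map_eq {α β : Type*} [MeasurableSpace α] [MeasurableSpace β]
    {π : Measure α} {f : α → β} (hf : Measurable f) {μ : ProbabilityMeasure β}
    (h : π.map f = (μ : Measure β)) : IsProbabilityMeasure π :=
  ⟨by rw [← preimage_univ (f := f), ← Measure.map_apply hf .univ, h]; exact measure_univ⟩

theorem integrable_of_continuous_prod {E : Type*} [NormedAddCommGroup E]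
    {f : State d A × State d A → E} (hf : Continuous f) (π : Measure (State d A × State d A))
    [IsFiniteMeasure π] : Integrable f π :=
  hf.integrable_of_hasCompactSupport (HasCompactSupport.of_compactSpace f)

variable {μ₀ ν₀ : ProbabilityMeasure (State d A)} {Φ Ψ : ℝ → State d A → State d A} {C C' : ℝ}

/-- The transport cost of the coupling obtained by moving the coupling `π` along two flows. -/
def flowCost (π : Measure (State d A × State d A)) (Φ Ψ : ℝ → State d A → State d A) (t : ℝ) : ℝ :=
  ∫ p, dX (Φ t p.1) (Ψ t p.2) ∂π

theorem continuous_dX_flow (hΦ : ∀ t, Continuous (Φ t)) (hΨ : ∀ t, Continuous (Ψ t)) (t : ℝ) :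
    Continuous fun p : State d A × State d A => dX (Φ t p.1) (Ψ t p.2) := by
  have h1 := hΦ t
  have h2 := hΨ t
  exact continuous_dX.comp (f := fun p : State d A × State d A => (Φ t p.1, Ψ t p.2))
    (by fun_prop)

/-- Both velocities are written as integrals against the same coupling `π`. Changing the first
argument of the kernel costs `L_V` times the distance of the pair, changing the second costs `Lμ`
times the average distance. Both flows stay on the sphere, so the kernel's own constants enter and
not the larger ones of its extension. -/
theorem flowCost_step (hreg : IsRegularKernel h gradh Lx Mh) (hs : SecondArgLipschitz gradh Lμ)
    (hf : FirstArgLipschitz gradh Lx) (hg : IsTangentKernel (tangentGrad gradh) M L K)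
    (hΦ : IsFlow (tangentGrad gradh) μ₀ Φ C) (hΨ : IsFlow (tangentGrad gradh) ν₀ Ψ C')
    {π : Measure (State d A × State d A)} [IsProbabilityMeasure π]
    (h1 : π.map Prod.fst = (μ₀ : Measure (State d A)))
    (h2 : π.map Prod.snd = (ν₀ : Measure (State d A))) {t ε : ℝ} (hε : 0 ≤ ε) :
    flowCost π Φ Ψ (t + ε)
      ≤ (1 + ((Lx + 2 * Mh) + Lμ) * ε) * flowCost π Φ Ψ t + (C + C') * ε ^ 2 := by
  have hcΦ := hΦ.continuous t
  have hcΨ := hΨ.continuous t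
  have hint : ∀ t, Integrable (fun p : State d A × State d A => dX (Φ t p.1) (Ψ t p.2)) π :=
    fun t => integrable_of_continuous_prod (continuous_dX_flow hΦ.continuous hΨ.continuous t) π
  have e1 : ∀ z, ∫ w, tangentGrad gradh (Φ t z) (Φ t w) ∂(μ₀ : Measure (State d A))
      = ∫ p, tangentGrad gradh (Φ t z) (Φ t p.1) ∂π := fun z => by
    rw [← h1, integral_map measurable_fst.aemeasurable]
    exact (integrable_of_continuous
      (hg.continuous.comp (f := fun w => (Φ t z, Φ t w)) (by fun_prop)) _).aestronglyMeasurable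
  have e2 : ∀ z, ∫ w, tangentGrad gradh (Ψ t z) (Ψ t w) ∂(ν₀ : Measure (State d A))
      = ∫ p, tangentGrad gradh (Ψ t z) (Ψ t p.2) ∂π := fun z => by
    rw [← h2, integral_map measurable_snd.aemeasurable]
    exact (integrable_of_continuous
      (hg.continuous.comp (f := fun w => (Ψ t z, Ψ t w)) (by fun_prop)) _).aestronglyMeasurable
  have hV : ∀ z z', ‖(∫ p, tangentGrad gradh (Φ t z) (Φ t p.1) ∂π)
      - ∫ p, tangentGrad gradh (Ψ t z') (Ψ t p.2) ∂π‖
      ≤ (Lx + 2 * Mh) * dX (Φ t z) (Ψ t z') + Lμ * flowCost π Φ Ψ t := by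
    intro z z'
    have i1 : Integrable (fun p : State d A × State d A => tangentGrad gradh (Φ t z) (Φ t p.1)) π :=
      integrable_of_continuous_prod
        (hg.continuous.comp (f := fun p : State d A × State d A => (Φ t z, Φ t p.1)) (by fun_prop)) π
    have i2 : Integrable (fun p : State d A × State d A => tangentGrad gradh (Ψ t z') (Ψ t p.2)) π :=
      integrable_of_continuous_prod
        (hg.continuous.comp (f := fun p : State d A × State d A => (Ψ t z', Ψ t p.2)) (by fun_prop)) π
    rw [← integral_sub i1 i2]
    have hi : Integrable (fun p : State d A × State d A => (Lx + 2 * Mh) * dX (Φ t z) (Ψ t z')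
        + Lμ * dX (Φ t p.1) (Ψ t p.2)) π := (integrable_const _).add ((hint t).const_mul _)
    refine (norm_integral_le_of_norm_le hi (ae_of_all _ fun p => ?_)).trans (le_of_eq ?_)
    · refine (norm_sub_le_norm_sub_add_norm_sub _ (tangentGrad gradh (Ψ t z') (Φ t p.1)) _).trans ?_
      exact add_le_add (hf.norm_tangentGrad_sub_le hreg _ _ _) (hs.norm_tangentGrad_sub_le _ _ _)
    · rw [integral_add (integrable_const _) ((hint t).const_mul _), integral_const, probReal_univ,
        one_smul, integral_const_mul, flowCost]
  have hpt : ∀ p : State d A × State d A, dX (Φ (t + ε) p.1) (Ψ (t + ε) p.2)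
      ≤ (1 + (Lx + 2 * Mh) * ε) * dX (Φ t p.1) (Ψ t p.2)
        + (ε * (Lμ * flowCost π Φ Ψ t) + (C + C') * ε ^ 2) := by
    intro p
    have r1 := hΦ.remainder t p.1 ε hε
    have r2 := hΨ.remainder t p.2 ε hε
    have r3 := mul_le_mul_of_nonneg_left (hV p.1 p.2) hε
    rw [e1] at r1
    rw [e2] at r2
    set V := ∫ q, tangentGrad gradh (Φ t p.1) (Φ t q.1) ∂π
    set V' := ∫ q, tangentGrad gradh (Ψ t p.2) (Ψ t q.2) ∂π
    have e : ((Φ (t + ε) p.1).1 : Amb d) - (Ψ (t + ε) p.2).1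
        = (((Φ (t + ε) p.1).1 : Amb d) - (Φ t p.1).1 - ε • V)
          - (((Ψ (t + ε) p.2).1 : Amb d) - (Ψ t p.2).1 - ε • V')
          + (((Φ t p.1).1 : Amb d) - (Ψ t p.2).1) + ε • (V - V') := by
      rw [smul_sub]; abel
    have n : ‖((Φ (t + ε) p.1).1 : Amb d) - (Ψ (t + ε) p.2).1‖
        ≤ C * ε ^ 2 + C' * ε ^ 2 + ‖((Φ t p.1).1 : Amb d) - (Ψ t p.2).1‖ + ε * ‖V - V'‖ := by
      rw [e]
      refine (norm_add_le _ _).trans ?_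
      rw [norm_smul, Real.norm_of_nonneg hε]
      refine add_le_add ((norm_add_le _ _).trans (add_le_add ?_ le_rfl)) le_rfl
      exact (norm_sub_le _ _).trans (add_le_add r1 r2)
    -- Labels are transported unchanged, so only the content part of `dX` evolves.
    have l1 : dist (Φ (t + ε) p.1).2 (Ψ (t + ε) p.2).2 = dist (Φ t p.1).2 (Ψ t p.2).2 := by
      rw [hΦ.label, hΨ.label, hΦ.label, hΨ.label]
    have l2 : dX (Φ t p.1) (Ψ t p.2)
        = ‖((Φ t p.1).1 : Amb d) - (Ψ t p.2).1‖ + dist (Φ t p.1).2 (Ψ t p.2).2 := rfl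
    rw [dX, l1]
    linarith
  have hi2 := (hint t).const_mul (1 + (Lx + 2 * Mh) * ε)
  refine (integral_mono (hint (t + ε)) (hi2.add (integrable_const _)) hpt).trans (le_of_eq ?_)
  simp only [Pi.add_apply]
  rw [integral_add hi2 (integrable_const _), integral_const_mul, integral_const, probReal_univ,
    one_smul, ← flowCost]
  ring

theorem flowCost_le (hreg : IsRegularKernel h gradh Lx Mh) (hs : SecondArgLipschitz gradh Lμ)
    (hf : FirstArgLipschitz gradh Lx) (hg : IsTangentKernel (tangentGrad gradh) M L K)
    (hΦ : IsFlow (tangentGrad gradh) μ₀ Φ C) (hΨ : IsFlow (tangentGrad gradh) ν₀ Ψ C')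
    {π : Measure (State d A × State d A)} [IsProbabilityMeasure π]
    (h1 : π.map Prod.fst = (μ₀ : Measure (State d A)))
    (h2 : π.map Prod.snd = (ν₀ : Measure (State d A))) {t : ℝ} (ht : 0 ≤ t) :
    flowCost π Φ Ψ t
      ≤ Real.exp (((Lx + 2 * Mh) + Lμ) * t) * ∫ p, dX p.1 p.2 ∂π := by
  obtain ⟨z₀⟩ := μ₀.nonempty
  have hLx := hreg.Lx_nonneg z₀
  have hMh := hreg.Mh_nonneg z₀
  have hLμ := hs.nonneg z₀
  have h0 : flowCost π Φ Ψ 0 = ∫ p, dX p.1 p.2 ∂π := by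
    simp only [flowCost, hΦ.zero, hΨ.zero]
  refine le_of_forall_pos_le_add fun κ hκ => ?_
  have key := gronwall_of_step (P := fun t u => flowCost π Φ Ψ t ≤ u)
    (a := (Lx + 2 * Mh) + Lμ) (η := 0) (C := C + C') (u₀ := ∫ p, dX p.1 p.2 ∂π) (by positivity)
    le_rfl (add_nonneg hΦ.C_nonneg hΨ.C_nonneg) (integral_nonneg fun p => dX_nonneg _ _)
    (fun t u v huv h => h.trans huv)
    (fun t u ε _ _ hε h => by
      refine (flowCost_step hreg hs hf hg hΦ hΨ h1 h2 hε).trans ?_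
      have := mul_le_mul_of_nonneg_left h (show 0 ≤ 1 + ((Lx + 2 * Mh) + Lμ) * ε by positivity)
      linarith) h0.le ht hκ
  rwa [mul_zero, add_zero] at key

/-- Stability of weak solutions in the Wasserstein distance. -/
theorem IsWeakSolution.W1_le (hreg : IsRegularKernel h gradh Lx Mh)
    (hs : SecondArgLipschitz gradh Lμ) (hf : FirstArgLipschitz gradh Lx)
    {μ ν : ℝ≥0 → ProbabilityMeasure (State d A)} (hμ : IsWeakSolution gradh μ)
    (hν : IsWeakSolution gradh ν) (τ : ℝ≥0) :
    W1 (μ τ) (ν τ) ≤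
      ENNReal.ofReal (Real.exp (((Lx + 2 * Mh) + Lμ) * (τ : ℝ))) * W1 (μ 0) (ν 0) := by
  obtain ⟨z₀⟩ := (μ 0).nonempty
  have hg := hreg.isTangentKernel hs z₀
  obtain ⟨Φ, C, hΦ⟩ := exists_isFlow hg (μ 0)
  obtain ⟨Ψ, C', hΨ⟩ := exists_isFlow hg (ν 0)
  have eμ : (μ τ : Measure (State d A)) = (μ 0 : Measure (State d A)).map (Φ τ) := by
    conv_lhs => rw [hμ.eq_flowLaw hs hg hΦ]
    rfl
  have eν : (ν τ : Measure (State d A)) = (ν 0 : Measure (State d A)).map (Ψ τ) := by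
    conv_lhs => rw [hν.eq_flowLaw hs hg hΨ]
    rfl
  have hmΦ := (hΦ.continuous τ).measurable
  have hmΨ := (hΨ.continuous τ).measurable
  -- A nonzero finite factor can be moved inside the infimum, which reduces the claim to one
  -- coupling `π` of the initial laws.
  have hE : ENNReal.ofReal (Real.exp (((Lx + 2 * Mh) + Lμ) * (τ : ℝ))) ≠ 0 :=
    (ENNReal.ofReal_pos.2 (Real.exp_pos _)).ne'
  rw [W1, W1, ENNReal.mul_iInf_of_ne hE ENNReal.ofReal_ne_top]
  refine le_iInf fun π => ?_
  rw [ENNReal.mul_iInf_of_ne hE ENNReal.ofReal_ne_top]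
  refine le_iInf fun hπ => ?_
  have hprob := isProbabilityMeasure_of_map_eq measurable_fst hπ.1
  have hm : Measurable (Prod.map (Φ τ) (Ψ τ)) := hmΦ.prodMap hmΨ
  -- The competitor at time `τ` is `π` pushed forward by the two flows.
  have hmarg : (π.map (Prod.map (Φ τ) (Ψ τ))).map Prod.fst = (μ τ : Measure (State d A)) ∧
      (π.map (Prod.map (Φ τ) (Ψ τ))).map Prod.snd = (ν τ : Measure (State d A)) := by
    constructor
    · rw [Measure.map_map measurable_fst hm, eμ, ← hπ.1, Measure.map_map hmΦ measurable_fst]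
      rfl
    · rw [Measure.map_map measurable_snd hm, eν, ← hπ.2, Measure.map_map hmΨ measurable_snd]
      rfl
  refine (iInf₂_le (π.map (Prod.map (Φ τ) (Ψ τ))) hmarg).trans ?_
  · rw [lintegral_map (continuous_dX.measurable.ennreal_ofReal) hm]
    have c1 := flowCost_le hreg hs hf hg hΦ hΨ hπ.1 hπ.2 τ.coe_nonneg
    rw [← ofReal_integral_eq_lintegral_ofReal (integrable_of_continuous_prod continuous_dX π)
      (ae_of_all _ fun p => dX_nonneg _ _), ← ENNReal.ofReal_mul (Real.exp_pos _).le]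
    rw [← ofReal_integral_eq_lintegral_ofReal (f := fun p : State d A × State d A =>
      dX (Prod.map (Φ τ) (Ψ τ) p).1 (Prod.map (Φ τ) (Ψ τ) p).2)
      (integrable_of_continuous_prod (continuous_dX_flow hΦ.continuous hΨ.continuous τ) π)
      (ae_of_all _ fun p => dX_nonneg _ _)]
    exact ENNReal.ofReal_le_ofReal c1

end Stability

/-! ### Empirical laws of particle systems -/

section Particles

variable {d : ℕ} {A : Type*} [MetricSpace A] [CompactSpace A] [MeasurableSpace A] [BorelSpace A]
  {gradh : State d A → State d A → Amb d} {M L K Lμ : ℝ}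

/-- The uniform probability measure on `Fin n`. -/
def uniformFin (n : ℕ) : Measure (Fin n) := (n : ℝ≥0∞)⁻¹ • ∑ i, Measure.dirac i

theorem isProbabilityMeasure_uniformFin (n : ℕ) [NeZero n] :
    IsProbabilityMeasure (uniformFin n) := ⟨by
  simp [uniformFin, ENNReal.inv_mul_cancel (Nat.cast_ne_zero.mpr (NeZero.ne n))
    (ENNReal.natCast_ne_top n)]⟩

theorem empiricalLaw_eq_map {n : ℕ} [NeZero n] (z : Fin n → State d A) :
    (empiricalLaw z : Measure (State d A)) = (uniformFin n).map z := by
  have hz : Measurable z := measurable_of_finite z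
  rw [uniformFin, Measure.map_smul, Measure.map_finset_sum hz.aemeasurable]
  simp only [Measure.map_dirac' hz]
  rfl

theorem velocity_empiricalLaw {n : ℕ} [NeZero n] (hs : SecondArgLipschitz gradh Lμ)
    (z : Fin n → State d A) (w : State d A) :
    velocity gradh (empiricalLaw z : Measure (State d A)) w
      = tangentProj w.1 ((n : ℝ)⁻¹ • ∑ j, gradh w (z j)) := by
  rw [velocity]
  change tangentProj w.1 (∫ y, gradh w y ∂((n : ℝ≥0∞)⁻¹ • ∑ i, Measure.dirac (z i))) = _
  rw [integral_smul_measure, integral_finsetSum_measure fun i _ =>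
    integrable_of_continuous (hs.continuous w) _]
  simp [ENNReal.toReal_inv]

/-- The randomness is the uniformly drawn particle index: the average over `j` in the particle
system is the integral against the empirical law. -/
theorem IsParticleSolution.isLagrangian {n : ℕ} [NeZero n] (hs : SecondArgLipschitz gradh Lμ)
    {ξ : Fin n → A} {x : Fin n → ℝ → Sph d} (hx : IsParticleSolution gradh ξ x) :
    IsLagrangian (uniformFin n) (fun t i => (x i t, ξ i)) gradh
      (fun τ : ℝ≥0 => empiricalLaw fun i => (x i (τ : ℝ), ξ i)) where
  law τ := empiricalLaw_eq_map _
  measurable t _ := measurable_of_finite _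
  label t _ i := rfl
  hasDerivWithinAt t ht i := by
    rw [velocity_empiricalLaw hs, Real.coe_toNNReal _ ht]
    exact hx i t ht

theorem IsParticleSolution.isWeakSolution {n : ℕ} [NeZero n] (hs : SecondArgLipschitz gradh Lμ)
    (hg : IsTangentKernel (tangentGrad gradh) M L K)
    {ξ : Fin n → A} {x : Fin n → ℝ → Sph d} (hx : IsParticleSolution gradh ξ x) :
    IsWeakSolution gradh (fun τ : ℝ≥0 => empiricalLaw fun i => (x i (τ : ℝ), ξ i)) :=
  have := isProbabilityMeasure_uniformFin n
  isWeakSolution_of_isLagrangian hs hg (hx.isLagrangian hs)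

end Particles

end USAAV

end

/-! ### Main theorem -/

theorem mainTheorem6 {d : ℕ} (hd : 2 ≤ d)
    {A : Type*} [MetricSpace A] [CompactSpace A] [MeasurableSpace A] [BorelSpace A]
    (h : USAAV.State d A → USAAV.State d A → ℝ)
    (gradh : USAAV.State d A → USAAV.State d A → USAAV.Amb d)
    (Lx Mh Lμ : ℝ)
    (hreg : USAAV.IsRegularKernel h gradh Lx Mh)
    (hsecond : USAAV.SecondArgLipschitz gradh Lμ) :
    -- global well-posedness
    (∀ μ₀ : ProbabilityMeasure (USAAV.State d A),
      ∃! μ : C(ℝ≥0, ProbabilityMeasure (USAAV.State d A)),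
        μ 0 = μ₀ ∧ USAAV.IsWeakSolution gradh μ) ∧
    (USAAV.FirstArgLipschitz gradh Lx →
      -- stability estimate, with `L_V = L_x + 2 M_h`
      (∀ μ ν : C(ℝ≥0, ProbabilityMeasure (USAAV.State d A)),
        USAAV.IsWeakSolution gradh μ → USAAV.IsWeakSolution gradh ν →
        ∀ τ : ℝ≥0, USAAV.W1 (μ τ) (ν τ) ≤
          ENNReal.ofReal (Real.exp (((Lx + 2 * Mh) + Lμ) * (τ : ℝ))) * USAAV.W1 (μ 0) (ν 0)) ∧
      -- mean-field limit for the empirical laws of `n + 1` particles, `n → ∞`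
      (∀ T : ℝ≥0, 0 < T → ∃ C : ℝ,
        ∀ (ρ : ProbabilityMeasure A) (μ : C(ℝ≥0, ProbabilityMeasure (USAAV.State d A)))
          (ξ : (n : ℕ) → Fin (n + 1) → A)
          (x : (n : ℕ) → Fin (n + 1) → ℝ → USAAV.Sph d),
          μ 0 ∈ USAAV.fixedMarginal ρ →
          USAAV.IsWeakSolution gradh μ →
          (∀ n, USAAV.IsParticleSolution gradh (ξ n) (x n)) →
          Tendsto (fun n => USAAV.W1 (USAAV.empiricalLaw fun i => (x n i 0, ξ n i)) (μ 0))
            atTop (𝓝 0) →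
          (∀ n, (⨆ τ ∈ Icc (0 : ℝ≥0) T,
              USAAV.W1 (USAAV.empiricalLaw fun i => (x n i (τ : ℝ), ξ n i)) (μ τ)) ≤
            ENNReal.ofReal (Real.exp C) *
              USAAV.W1 (USAAV.empiricalLaw fun i => (x n i 0, ξ n i)) (μ 0)) ∧
          Tendsto (fun n => ⨆ τ ∈ Icc (0 : ℝ≥0) T,
              USAAV.W1 (USAAV.empiricalLaw fun i => (x n i (τ : ℝ), ξ n i)) (μ τ))
            atTop (𝓝 0))) := by
  refine ⟨fun μ₀ => ?_, fun hfirst => ⟨fun μ ν hμ hν τ => hμ.W1_le hreg hsecond hfirst hν τ, ?_⟩⟩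
  · obtain ⟨z₀⟩ := μ₀.nonempty
    have hg := hreg.isTangentKernel hsecond z₀
    obtain ⟨Φ, C, hΦ⟩ := USAAV.exists_isFlow hg μ₀
    have hlag := hΦ.isLagrangian hsecond hg
    have h0 := USAAV.flowLaw_zero μ₀ hΦ.continuous hΦ.zero
    have hw := USAAV.isWeakSolution_of_isLagrangian hsecond hg hlag
    refine ⟨⟨USAAV.flowLaw μ₀ Φ hΦ.continuous, hlag.continuous⟩, ⟨h0, hw⟩, fun ν hν => ?_⟩
    exact DFunLike.coe_injective (hν.2.eq_of_zero_eq hsecond hg hw (hν.1.trans h0.symm))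
  · intro T _
    -- The stability exponent at the final time; it dominates the exponents at all `τ ≤ T` and does
    -- not depend on `ρ`, on the solution or on `n`.
    refine ⟨((Lx + 2 * Mh) + Lμ) * T, fun ρ μ ξ x _ hμ hx hlim => ?_⟩
    obtain ⟨z₀⟩ := (μ 0).nonempty
    have hg := hreg.isTangentKernel hsecond z₀
    have hLx := hreg.Lx_nonneg z₀
    have hMh := hreg.Mh_nonneg z₀
    have hLμ := hsecond.nonneg z₀
    have hbound : ∀ n, (⨆ τ ∈ Icc (0 : ℝ≥0) T,
        USAAV.W1 (USAAV.empiricalLaw fun i => (x n i (τ : ℝ), ξ n i)) (μ τ)) ≤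
        ENNReal.ofReal (Real.exp (((Lx + 2 * Mh) + Lμ) * T)) *
          USAAV.W1 (USAAV.empiricalLaw fun i => (x n i 0, ξ n i)) (μ 0) := by
      intro n
      refine iSup₂_le fun τ hτ => ?_
      have h1 := ((hx n).isWeakSolution hsecond hg).W1_le hreg hsecond hfirst hμ τ
      rw [NNReal.coe_zero] at h1
      refine h1.trans (mul_le_mul_left (ENNReal.ofReal_le_ofReal (Real.exp_le_exp.2 ?_)) _)
      exact mul_le_mul_of_nonneg_left (NNReal.coe_le_coe.2 hτ.2) (by positivity)
    refine ⟨hbound, ?_⟩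
    have h2 := ENNReal.Tendsto.const_mul
      (a := ENNReal.ofReal (Real.exp (((Lx + 2 * Mh) + Lμ) * T))) hlim
      (Or.inr ENNReal.ofReal_ne_top)
    rw [mul_zero] at h2
    exact tendsto_of_tendsto_of_tendsto_of_le_of_le tendsto_const_nhds h2 (fun _ => zero_le)
      hbound
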